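/- Let $0<q<1$. For a polynomial $f\in\mathbb{C}[x]$ put $\breve f(z)=f\big((z+z^{-1})/2\big)$, and let $\mathcal{D}_qf$ and $\mathcal{S}_qf$ be the polynomials determined, for $x=(z+z^{-1})/2$, by $$\mathcal{D}_qf(x)=\frac{\breve f(q^{1/2}z)-\breve f(q^{-1/2}z)}{\breve e(q^{1/2}z)-\breve e(q^{-1/2}z)}\quad(e(x)=x,\ z\neq 0,\pm1),\qquad \mathcal{S}_qf(x)=\frac{\breve f(q^{1/2}z)+\breve f(q^{-1/2}z)}{2}\quad(z\ne0).$$ A sequence $(P_n)_{n\ge0}$ in $\mathbb{C}[x]$ with $\deg P_n=n$ is an orthogonal polynomial sequence (OPS) if there are a linear functional $\mathbf u$ on $\mathbb{C}[x]$ and numbers $\kappa_n\in\mathbb{C}\setminus\{0\}$ with $\langle\mathbf u,P_nP_m\rangle=\kappa_n\delta_{n,m}$ for all $n,m$. For $a_1,\dots,a_4\in\mathbb{C}$ with $\sigma=a_1a_2a_3a_4$, the monic Askey-Wilson polynomials $Q_n(x;a_1,a_2,a_3,a_4|q)$ are defined by $Q_{-1}=0$, $Q_0=1$, $Q_{n+1}=(x-B_n)Q_n-C_nQ_{n-1}$,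 where $$2B_n=a_1+\frac1{a_1}-\frac{(1-a_1a_2q^n)(1-a_1a_3q^n)(1-a_1a_4q^n)(1-\sigma q^{n-1})}{a_1(1-\sigma q^{2n-1})(1-\sigma q^{2n})}-\frac{a_1(1-q^n)(1-a_2a_3q^{n-1})(1-a_2a_4q^{n-1})(1-a_3a_4q^{n-1})}{(1-\sigma q^{2n-1})(1-\sigma q^{2n-2})}$$ (the last term being $0$ for $n=0$) and $$C_{n+1}=\frac{(1-q^{n+1})(1-\sigma q^{n-1})\prod_{1\le i<j\le4}(1-a_ia_jq^n)}{4(1-\sigma q^{2n-1})(1-\sigma q^{2n})^2(1-\sigma q^{2n+1})}.$$ Call the parameters admissible if $a_1\ne0$, $\sigma\neq q$, and $(1-\sigma q^n)\prod_{i<j}(1-a_ia_jq^n)\neq0$ for all $n\ge0$. A sequence $(P_n)$ is called an Askey-Wilson sequence, or a special or limiting case of one, if there are nonzero constants $k_n$, polynomials $Q_n$ with $P_n=k_nQ_n$, and a sequence $(a^{(j)})_{j\ge0}$ of admissible parameter quadruples, independent of $n$, such that for every $n$ the polynomials $Q_n(x;a^{(j)}_1,a^{(j)}_2,a^{(j)}_3,a^{(j)}_4|q)$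 converge coefficientwise to $Q_n$ as $j\to\infty$. **Corollary.** Let $(P_n)_{n\ge0}$ be an OPS, let $a,b,c\in\mathbb{C}$, and let $(a_n)_{n\ge0},(b_n)_{n\ge0},(c_n)_{n\ge0}$ be sequences of complex numbers with $c_n\ne0$ for every $n$, such that $$(ax^2+bx+c)\,\mathcal{S}_q\mathcal{D}_qP_n=a_nP_{n+1}+b_nP_n+c_nP_{n-1}\qquad(n=0,1,\dots;\ P_{-1}=0).$$ Then $(P_n)_{n\ge0}$ is an Askey-Wilson sequence (with the same $q$), or a special or limiting case of one. -/

import Mathlib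

open Polynomial Filter Topology

noncomputable section

/-- The lattice map `x = (z + 1/z)/2`; for `z = e^{iθ}` it is `cos θ`. -/
def latticePt (z : ℂ) : ℂ := (z + z⁻¹) / 2

/-- `f̆(z) = f((z + 1/z)/2)`, so that `f̆(e^{iθ}) = f(cos θ)`. -/
def breve (f : ℂ[X]) (z : ℂ) : ℂ := f.eval (latticePt z)

/-- `q^{1/2}` as a complex number. -/
def sqrtQ (q : ℝ) : ℂ := (Real.sqrt q : ℂ)

/-- `g` is the image of `f` under the Askey-Wilson divided difference operator: at `x = (z + 1/z)/2`
the value of `g` is the divided difference of `f̆` over the points `q^{1/2} z`, `q^{-1/2} z`. The points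
`z = 1, -1`, where that quotient is `0 / 0`, are left out. -/
def IsAWDiff (q : ℝ) (f g : ℂ[X]) : Prop :=
  ∀ z : ℂ, z ≠ 0 → z ^ 2 ≠ 1 →
    g.eval (latticePt z) =
      (breve f (sqrtQ q * z) - breve f ((sqrtQ q)⁻¹ * z)) /
        (breve X (sqrtQ q * z) - breve X ((sqrtQ q)⁻¹ * z))

/-- `g` is the image of `f` under the averaging operator. -/
def IsAWAver (q : ℝ) (f g : ℂ[X]) : Prop :=
  ∀ z : ℂ, z ≠ 0 →
    g.eval (latticePt z) = (breve f (sqrtQ q * z) + breve f ((sqrtQ q)⁻¹ * z)) / 2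

open Classical in
/-- The Askey-Wilson operator `D_q` on polynomials (for `0 < q < 1` the polynomial exists and is
unique, see `awDiff_spec` and `IsAWDiff.unique`). -/
def awDiff (q : ℝ) (f : ℂ[X]) : ℂ[X] :=
  if h : ∃ g, IsAWDiff q f g then h.choose else 0

open Classical in
/-- The averaging operator `S_q` on polynomials (for `0 < q < 1` the polynomial exists and is
unique, see `awAver_spec` and `IsAWAver.unique`). -/
def awAver (q : ℝ) (f : ℂ[X]) : ℂ[X] :=
  if h : ∃ g, IsAWAver q f g then h.choose else 0

theorem exists_awDiff_awAver_aux {p : ℂ} (hp : p ≠ 0) (f : ℂ[X]) :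
    ∃ g h : ℂ[X], ∀ z : ℂ, z ≠ 0 →
      breve f (p * z) - breve f (p⁻¹ * z) =
        g.eval (latticePt z) * (latticePt (p * z) - latticePt (p⁻¹ * z)) ∧
      breve f (p * z) + breve f (p⁻¹ * z) = 2 * h.eval (latticePt z) := by
  induction f using Polynomial.induction_on' with
  | add f₁ f₂ h₁ h₂ =>
    obtain ⟨g₁, k₁, H₁⟩ := h₁
    obtain ⟨g₂, k₂, H₂⟩ := h₂
    refine ⟨g₁ + g₂, k₁ + k₂, fun z hz => ?_⟩
    have e₁ := H₁ z hz
    have e₂ := H₂ z hz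
    simp only [breve, eval_add] at *
    constructor
    · linear_combination e₁.1 + e₂.1
    · linear_combination e₁.2 + e₂.2
  | monomial n a =>
    induction n with
    | zero =>
      refine ⟨0, C a, fun z hz => ?_⟩
      simp only [breve, eval_monomial, eval_zero, eval_C]
      constructor <;> ring
    | succ n ih =>
      obtain ⟨g, h, H⟩ := ih
      refine ⟨g * (C ((p + p⁻¹) / 2) * X) + h,
        h * (C ((p + p⁻¹) / 2) * X) + g * (C (((p + p⁻¹) / 2) ^ 2 - 1) * (X ^ 2 - 1)),
        fun z hz => ?_⟩
      obtain ⟨e₁, e₂⟩ := H z hz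
      have s₁ : latticePt (p * z) + latticePt (p⁻¹ * z) =
          2 * ((p + p⁻¹) / 2 * latticePt z) := by
        simp only [latticePt]; field_simp; ring
      have s₂ : (latticePt (p * z) - latticePt (p⁻¹ * z)) ^ 2 =
          4 * ((((p + p⁻¹) / 2) ^ 2 - 1) * (latticePt z ^ 2 - 1)) := by
        simp only [latticePt]; field_simp; ring
      simp only [breve, eval_monomial, eval_add, eval_mul, eval_C, eval_X, eval_sub, eval_pow,
        eval_one, pow_succ (latticePt (p * z)), pow_succ (latticePt (p⁻¹ * z))] at *
      generalize latticePt (p * z) = A at *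
      generalize latticePt (p⁻¹ * z) = B at *
      generalize latticePt z = x at *
      generalize eval x g = G at *
      generalize eval x h = K at *
      generalize (p + p⁻¹) / 2 = r at *
      constructor
      · linear_combination (A + B) / 2 * e₁ + (A - B) / 2 * e₂ + G * (A - B) / 2 * s₁
      · linear_combination (A + B) / 2 * e₂ + (A - B) / 2 * e₁ + K * s₁ + G / 2 * s₂

theorem sqrtQ_ne_zero {q : ℝ} (hq : 0 < q) : sqrtQ q ≠ 0 := by
  simp [sqrtQ, Real.sqrt_ne_zero'.2 hq]

theorem latticePt_sub_ne_zero {q : ℝ} (hq : 0 < q) (hq1 : q < 1) {z : ℂ} (hz : z ≠ 0)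
    (hz1 : z ^ 2 ≠ 1) :
    latticePt (sqrtQ q * z) - latticePt ((sqrtQ q)⁻¹ * z) ≠ 0 := by
  have hp := sqrtQ_ne_zero hq
  have hp2 : sqrtQ q ^ 2 ≠ 1 := by
    have h : sqrtQ q ^ 2 = (q : ℂ) := by
      rw [sqrtQ, ← Complex.ofReal_pow, Real.sq_sqrt hq.le]
    rw [h]
    exact_mod_cast hq1.ne
  have h : latticePt (sqrtQ q * z) - latticePt ((sqrtQ q)⁻¹ * z) =
      (sqrtQ q ^ 2 - 1) * (z ^ 2 - 1) / (2 * sqrtQ q * z) := by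
    simp only [latticePt]; field_simp; ring
  rw [h]
  exact div_ne_zero (mul_ne_zero (sub_ne_zero.2 hp2) (sub_ne_zero.2 hz1))
    (mul_ne_zero (mul_ne_zero two_ne_zero hp) hz)

theorem awDiff_spec {q : ℝ} (hq : 0 < q) (hq1 : q < 1) (f : ℂ[X]) : IsAWDiff q f (awDiff q f) := by
  have h : ∃ g, IsAWDiff q f g := by
    obtain ⟨g, _, H⟩ := exists_awDiff_awAver_aux (sqrtQ_ne_zero hq) f
    refine ⟨g, fun z hz hz1 => ?_⟩
    have h0 := latticePt_sub_ne_zero hq hq1 hz hz1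
    rw [(H z hz).1]
    simp only [breve, eval_X]
    rw [mul_div_cancel_right₀ _ h0]
  rw [awDiff, dif_pos h]
  exact h.choose_spec

theorem awAver_spec {q : ℝ} (hq : 0 < q) (f : ℂ[X]) : IsAWAver q f (awAver q f) := by
  have h : ∃ g, IsAWAver q f g := by
    obtain ⟨_, g, H⟩ := exists_awDiff_awAver_aux (sqrtQ_ne_zero hq) f
    refine ⟨g, fun z hz => ?_⟩
    rw [(H z hz).2]
    ring
  rw [awAver, dif_pos h]
  exact h.choose_spec

theorem exists_latticePt (w : ℂ) (hw : w ^ 2 ≠ 1) :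
    ∃ z : ℂ, z ≠ 0 ∧ z ^ 2 ≠ 1 ∧ latticePt z = w := by
  obtain ⟨s, hs⟩ := IsAlgClosed.exists_pow_nat_eq (w ^ 2 - 1) (n := 2) two_pos
  have h1 : (w + s) * (w - s) = 1 := by linear_combination -hs
  have h0 : w + s ≠ 0 := left_ne_zero_of_mul_eq_one h1
  have hl : latticePt (w + s) = w := by
    rw [latticePt, inv_eq_of_mul_eq_one_right h1]; ring
  refine ⟨w + s, h0, fun h => hw ?_, hl⟩
  have h2 : (w + s)⁻¹ = w + s := inv_eq_of_mul_eq_one_right (by rw [← sq]; exact h)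
  have h3 : latticePt (w + s) = w + s := by rw [latticePt, h2]; ring
  rw [← h, ← h3, hl]

theorem eq_of_eval_latticePt {g₁ g₂ : ℂ[X]}
    (h : ∀ z : ℂ, z ≠ 0 → z ^ 2 ≠ 1 → g₁.eval (latticePt z) = g₂.eval (latticePt z)) :
    g₁ = g₂ := by
  apply Polynomial.eq_of_infinite_eval_eq
  have hfin : ({1, -1} : Set ℂ).Finite := by simp
  refine hfin.infinite_compl.mono fun w hw => ?_
  have hw' : w ^ 2 ≠ 1 := fun h2 => hw (by simpa using h2)
  obtain ⟨z, hz, hz1, rfl⟩ := exists_latticePt w hw'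
  exact h z hz hz1

theorem IsAWDiff.unique {q : ℝ} {f g₁ g₂ : ℂ[X]} (h₁ : IsAWDiff q f g₁) (h₂ : IsAWDiff q f g₂) :
    g₁ = g₂ :=
  eq_of_eval_latticePt fun z hz hz1 => (h₁ z hz hz1).trans (h₂ z hz hz1).symm

theorem IsAWAver.unique {q : ℝ} {f g₁ g₂ : ℂ[X]} (h₁ : IsAWAver q f g₁) (h₂ : IsAWAver q f g₂) :
    g₁ = g₂ :=
  eq_of_eval_latticePt fun z hz _ => (h₁ z hz).trans (h₂ z hz).symm

/-- `(P_n)` is an orthogonal polynomial sequence: `deg P_n = n` and there is a linear functional `u` on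
`ℂ[X]` with `⟨u, P_n P_m⟩ = κ_n δ_{nm}`, `κ_n ≠ 0`. -/
def IsOPS (P : ℕ → ℂ[X]) : Prop :=
  (∀ n, (P n).degree = (n : WithBot ℕ)) ∧
    ∃ u : ℂ[X] →ₗ[ℂ] ℂ, ∃ κ : ℕ → ℂ, (∀ n, κ n ≠ 0) ∧
      ∀ n m, u (P n * P m) = if n = m then κ n else 0

/-- The product `a₁ a₂ a₃ a₄` of the four Askey-Wilson parameters. -/
def awProd (a : Fin 4 → ℂ) : ℂ := a 0 * a 1 * a 2 * a 3

/-- The recurrence coefficient `B_n` of the monic Askey-Wilson polynomials. -/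
def awB (q : ℝ) (a : Fin 4 → ℂ) (n : ℕ) : ℂ :=
  (a 0 + 1 / a 0
    - (1 - a 0 * a 1 * (q : ℂ) ^ n) * (1 - a 0 * a 2 * (q : ℂ) ^ n) * (1 - a 0 * a 3 * (q : ℂ) ^ n)
        * (1 - awProd a * (q : ℂ) ^ ((n : ℤ) - 1)) /
      (a 0 * (1 - awProd a * (q : ℂ) ^ (2 * (n : ℤ) - 1)) * (1 - awProd a * (q : ℂ) ^ (2 * n)))
    - a 0 * (1 - (q : ℂ) ^ n) * (1 - a 1 * a 2 * (q : ℂ) ^ ((n : ℤ) - 1))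
        * (1 - a 1 * a 3 * (q : ℂ) ^ ((n : ℤ) - 1)) * (1 - a 2 * a 3 * (q : ℂ) ^ ((n : ℤ) - 1)) /
      ((1 - awProd a * (q : ℂ) ^ (2 * (n : ℤ) - 1))
        * (1 - awProd a * (q : ℂ) ^ (2 * (n : ℤ) - 2)))) / 2

/-- The recurrence coefficient `C_{n+1}` of the monic Askey-Wilson polynomials. -/
def awCSucc (q : ℝ) (a : Fin 4 → ℂ) (n : ℕ) : ℂ :=
  (1 - (q : ℂ) ^ (n + 1)) * (1 - awProd a * (q : ℂ) ^ ((n : ℤ) - 1)) *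
    ((1 - a 0 * a 1 * (q : ℂ) ^ n) * (1 - a 0 * a 2 * (q : ℂ) ^ n) * (1 - a 0 * a 3 * (q : ℂ) ^ n)
      * (1 - a 1 * a 2 * (q : ℂ) ^ n) * (1 - a 1 * a 3 * (q : ℂ) ^ n)
      * (1 - a 2 * a 3 * (q : ℂ) ^ n)) /
    (4 * (1 - awProd a * (q : ℂ) ^ (2 * (n : ℤ) - 1)) * (1 - awProd a * (q : ℂ) ^ (2 * n)) ^ 2
      * (1 - awProd a * (q : ℂ) ^ (2 * n + 1)))

/-- The monic Askey-Wilson polynomials `Q_n(x; a₁, a₂, a₃, a₄ | q)`, by their three-term recurrence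
relation `Q_{n+1} = (x - B_n) Q_n - C_n Q_{n-1}`. -/
def awMonic (q : ℝ) (a : Fin 4 → ℂ) : ℕ → ℂ[X]
  | 0 => 1
  | 1 => X - C (awB q a 0)
  | n + 2 => (X - C (awB q a (n + 1))) * awMonic q a (n + 1) - C (awCSucc q a n) * awMonic q a n

/-- The parameters for which the formulas for `B_n` and `C_{n+1}` apply as they stand and give
`C_{n+1} ≠ 0`: besides the usual restrictions, `a₁ ≠ 0` and `a₁a₂a₃a₄ ≠ q`, where the formulas only
have removable singularities; these values are reached as limits. -/
def AWAdmissible (q : ℝ) (a : Fin 4 → ℂ) : Prop :=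
  a 0 ≠ 0 ∧ awProd a ≠ q ∧
    ∀ n : ℕ, (1 - awProd a * (q : ℂ) ^ n) * (1 - a 0 * a 1 * (q : ℂ) ^ n)
      * (1 - a 0 * a 2 * (q : ℂ) ^ n) * (1 - a 0 * a 3 * (q : ℂ) ^ n)
      * (1 - a 1 * a 2 * (q : ℂ) ^ n) * (1 - a 1 * a 3 * (q : ℂ) ^ n)
      * (1 - a 2 * a 3 * (q : ℂ) ^ n) ≠ 0

/-- `(P_n)` consists of nonzero multiples of the Askey-Wilson polynomials with base `q`, or of a
special or limiting case of them: `P_n = k_n Q_n`, `k_n ≠ 0`, where each monic polynomial `Q_n` is the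
coefficientwise limit of the monic Askey-Wilson polynomials of degree `n` along one sequence of
admissible parameters, the same for all `n`. A constant sequence gives the Askey-Wilson polynomials
themselves. -/
def IsAskeyWilsonOrLimit (q : ℝ) (P : ℕ → ℂ[X]) : Prop :=
  ∃ a : ℕ → Fin 4 → ℂ, (∀ j, AWAdmissible q (a j)) ∧
    ∃ (k : ℕ → ℂ) (Q : ℕ → ℂ[X]), (∀ n, k n ≠ 0) ∧ (∀ n, P n = C (k n) * Q n) ∧
      ∀ n i, Tendsto (fun j => (awMonic q (a j) n).coeff i) atTop (𝓝 ((Q n).coeff i))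

end

noncomputable section

/-! Write `T = S_q D_q`, `k = q + q⁻¹`, `K = 1 - k²/4`, `π = ax² + bx + c`. At `x = latticePt z`, `T
f` is the mean of the divided differences of `f` over `x, y` and `x, y'`, with `y, y'` the lattice
points of `q z` and `z / q`. Both neighbours satisfy `x² - k x y + y² = K`, so in `X² T - k X T X +
T X² - K T` the values of `f` at `y, y'` cancel and only multiplication by a polynomial remains
(`awAverDiff_X_sq`). In the skew part `A` of the form `⟨u, f π T g⟩` this symmetric term cancels too
(`structureForm_X_sq`). The structure relation makes `A` tridiagonal in the orthogonal basis, with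
zero diagonal, so the identity yields scalar recurrences for `A(Q_{n+1}, Q_n)` and the recurrence
coefficients `B_n`, `G_n` of the monic `Q_n` (`tridiagonal_recurrences`).

Divided by `κ_{n+1}`, these entries obey `d_n - k d_{n+1} + d_{n+2} = 0`, hence `d_n = e₀ q⁻ⁿ - e₄
qⁿ`. The other two recurrences telescope and determine `B_n` and `G_n`; the data `B_0, B_1, G_1` are
encoded in `e₁, e₂, e₃`. Here `G_{n+1}` contains the resolvent cubic of `e₀x⁴ - e₁x³ + e₂x² - e₃x +
e₄`, which factors into the products `1 - a_i a_j qⁿ` over the roots `a_i`: these are the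
Askey-Wilson coefficients. The denominators do not vanish: `d_0 ≠ 0` because `c_1 ≠ 0`, and `e₀ = e₄
qᵐ` would force `G_{m+2} = 0` by a reflection argument (`ne_mul_pow`).

The roots may fail to exist as four parameters (`e₀ = 0`) or to be admissible. Therefore `E = (e₀,
…, e₄)` is approached along generic points of a line, and continuity of the coefficients at `E`
gives the limit (`exists_admissible_seq`). -/

/-! ### The operator `S_q D_q` and its double commutation with `X` -/

theorem sqrtQ_sq {q : ℝ} (hq : 0 < q) : sqrtQ q ^ 2 = (q : ℂ) := by
  rw [sqrtQ, ← Complex.ofReal_pow, Real.sq_sqrt hq.le]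

theorem eq_of_eval_latticePt_of_finite {g₁ g₂ : ℂ[X]} {s : Set ℂ} (hs : s.Finite)
    (h : ∀ z : ℂ, z ≠ 0 → z ^ 2 ≠ 1 → z ∉ s → g₁.eval (latticePt z) = g₂.eval (latticePt z)) :
    g₁ = g₂ := by
  apply Polynomial.eq_of_infinite_eval_eq
  have hfin : (({1, -1} : Set ℂ) ∪ latticePt '' s).Finite :=
    Set.Finite.union (by simp) (hs.image _)
  refine hfin.infinite_compl.mono fun w hw => ?_
  have hw' : w ^ 2 ≠ 1 := fun h2 => hw (Or.inl (by simpa using h2))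
  obtain ⟨z, hz, hz1, rfl⟩ := exists_latticePt w hw'
  exact h z hz hz1 fun hzs => hw (Or.inr ⟨z, hzs, rfl⟩)

theorem finite_setOf_sq_eq (a : ℂ) : {z : ℂ | z ^ 2 = a}.Finite := by
  have h : (X ^ 2 - C a : ℂ[X]) ≠ 0 := X_pow_sub_C_ne_zero two_pos a
  refine ((X ^ 2 - C a : ℂ[X]).roots.toFinset.finite_toSet).subset fun z hz => ?_
  simp only [Set.mem_ofPred_eq] at hz
  simp [h, hz]

/-- The composition of the averaging operator with the Askey-Wilson operator. -/
def awAverDiff (q : ℝ) (f : ℂ[X]) : ℂ[X] := awAver q (awDiff q f)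

theorem latticePt_mul_sub {c z : ℂ} (hc : c ≠ 0) (hz : z ≠ 0) :
    latticePt (c * z) - latticePt z = (c - 1) * (c * z ^ 2 - 1) / (2 * c * z) := by
  simp only [latticePt]; field_simp; ring

/-- The points with `z² = q` or `z² = q⁻¹` are excluded because there `D_q` would be evaluated at
`±1`. -/
theorem eval_awAverDiff {q : ℝ} (hq : 0 < q) (hq1 : q < 1) (f : ℂ[X]) {z : ℂ} (hz : z ≠ 0)
    (h₁ : z ^ 2 ≠ q) (h₂ : z ^ 2 ≠ (q : ℂ)⁻¹) :
    (awAverDiff q f).eval (latticePt z) =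
      ((f.eval (latticePt (q * z)) - f.eval (latticePt z)) /
          (latticePt (q * z) - latticePt z)
        + (f.eval (latticePt z) - f.eval (latticePt ((q : ℂ)⁻¹ * z))) /
          (latticePt z - latticePt ((q : ℂ)⁻¹ * z))) / 2 := by
  have hp := sqrtQ_ne_zero hq
  have hp2 := sqrtQ_sq hq
  have hqc : (q : ℂ) ≠ 0 := by exact_mod_cast hq.ne'
  rw [awAverDiff, awAver_spec hq _ z hz, breve, breve,
    awDiff_spec hq hq1 f (sqrtQ q * z) (mul_ne_zero hp hz),
    awDiff_spec hq hq1 f ((sqrtQ q)⁻¹ * z) (mul_ne_zero (inv_ne_zero hp) hz)]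
  · simp only [breve, eval_X, ← mul_assoc, mul_inv_cancel₀ hp, inv_mul_cancel₀ hp, one_mul,
      ← sq, inv_pow, hp2]
  · rw [mul_pow, inv_pow, hp2]
    intro h
    apply h₁
    field_simp at h
    exact h
  · rw [mul_pow, hp2]
    intro h
    exact h₂ (eq_inv_of_mul_eq_one_right h)

theorem awAverDiff_eq_of_eval {q : ℝ} {g₁ g₂ : ℂ[X]}
    (h : ∀ z : ℂ, z ≠ 0 → z ^ 2 ≠ 1 → z ^ 2 ≠ q → z ^ 2 ≠ (q : ℂ)⁻¹ →
      g₁.eval (latticePt z) = g₂.eval (latticePt z)) : g₁ = g₂ :=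
  eq_of_eval_latticePt_of_finite ((finite_setOf_sq_eq (q : ℂ)).union
    (finite_setOf_sq_eq (q : ℂ)⁻¹)) fun z hz hz1 hs => h z hz hz1
      (fun h1 => hs (Or.inl h1)) (fun h2 => hs (Or.inr h2))

theorem awAverDiff_add {q : ℝ} (hq : 0 < q) (hq1 : q < 1) (f g : ℂ[X]) :
    awAverDiff q (f + g) = awAverDiff q f + awAverDiff q g := by
  refine awAverDiff_eq_of_eval (q := q) fun z hz _ h₁ h₂ => ?_
  simp only [eval_add, eval_awAverDiff hq hq1 _ hz h₁ h₂]
  ring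

theorem awAverDiff_smul {q : ℝ} (hq : 0 < q) (hq1 : q < 1) (c : ℂ) (f : ℂ[X]) :
    awAverDiff q (c • f) = c • awAverDiff q f := by
  refine awAverDiff_eq_of_eval (q := q) fun z hz _ h₁ h₂ => ?_
  simp only [eval_smul, eval_awAverDiff hq hq1 _ hz h₁ h₂, smul_eq_mul]
  ring

theorem awAverDiff_C {q : ℝ} (hq : 0 < q) (hq1 : q < 1) (c : ℂ) :
    awAverDiff q (C c) = 0 := by
  refine awAverDiff_eq_of_eval (q := q) fun z hz _ h₁ h₂ => ?_
  simp [eval_awAverDiff hq hq1 _ hz h₁ h₂]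

/-- Double commutation of `S_q D_q` with multiplication by `x`. -/
theorem awAverDiff_X_sq {q : ℝ} (hq : 0 < q) (hq1 : q < 1) (f : ℂ[X]) :
    X ^ 2 * awAverDiff q f - C ((q : ℂ) + (q : ℂ)⁻¹) * (X * awAverDiff q (X * f))
        + awAverDiff q (X ^ 2 * f) - C (1 - ((q : ℂ) + (q : ℂ)⁻¹) ^ 2 / 4) * awAverDiff q f =
      C ((2 - ((q : ℂ) + (q : ℂ)⁻¹)) / 2) * (X * f) := by
  have hqc : (q : ℂ) ≠ 0 := by exact_mod_cast hq.ne'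
  have hqc1 : (q : ℂ) - 1 ≠ 0 := sub_ne_zero.2 (by exact_mod_cast hq1.ne)
  refine awAverDiff_eq_of_eval (q := q) fun z hz _ h₁ h₂ => ?_
  simp only [eval_add, eval_sub, eval_mul, eval_C, eval_X, eval_pow,
    eval_awAverDiff hq hq1 _ hz h₁ h₂]
  have e₁ : latticePt (q * z) - latticePt z ≠ 0 := by
    rw [latticePt_mul_sub hqc hz]
    refine div_ne_zero (mul_ne_zero hqc1 (sub_ne_zero.2 fun h => h₂ ?_)) (by simp [hqc, hz])
    exact eq_inv_of_mul_eq_one_right h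
  have e₂ : latticePt z - latticePt ((q : ℂ)⁻¹ * z) ≠ 0 := by
    rw [← neg_sub, latticePt_mul_sub (inv_ne_zero hqc) hz, neg_ne_zero]
    refine div_ne_zero (mul_ne_zero ?_ (sub_ne_zero.2 fun h => h₁ ?_)) (by simp [hqc, hz])
    · rw [sub_ne_zero]; intro h; apply hqc1; rw [inv_eq_one.1 h]; ring
    · field_simp at h; exact h
  have r₁ : latticePt z ^ 2 + latticePt (q * z) ^ 2
      - ((q : ℂ) + (q : ℂ)⁻¹) * (latticePt z * latticePt (q * z))
      = 1 - ((q : ℂ) + (q : ℂ)⁻¹) ^ 2 / 4 := by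
    simp only [latticePt]; field_simp; ring
  have r₂ : latticePt (q * z) + latticePt ((q : ℂ)⁻¹ * z) =
      ((q : ℂ) + (q : ℂ)⁻¹) * latticePt z := by
    simp only [latticePt]; field_simp; ring
  generalize latticePt (q * z) = y at *
  generalize latticePt ((q : ℂ)⁻¹ * z) = y' at *
  generalize latticePt z = x at *
  generalize (q : ℂ) + (q : ℂ)⁻¹ = k at *
  -- By the conic relation the factor left in front of `f(x)` is `(2 - k) x² - K = (x - y)(x - y')`,
  -- which cancels both denominators.
  obtain rfl : y' = k * x - y := by linear_combination r₂
  rw [← r₁]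
  have i₁ := mul_inv_cancel₀ e₁
  have i₂ := mul_inv_cancel₀ e₂
  simp only [div_eq_mul_inv _ (y - x), div_eq_mul_inv _ (x - (k * x - y))]
  generalize (y - x)⁻¹ = α at *
  generalize (x - (k * x - y))⁻¹ = β at *
  generalize eval x f = F at *
  linear_combination -F * (y - x) / 2 * i₂ + F * (x - (k * x - y)) / 2 * i₁

/-! ### Orthogonal sequences and the three-term recurrence -/

section Orthogonality

variable {Q : ℕ → ℂ[X]} {u : ℂ[X] →ₗ[ℂ] ℂ} {κ : ℕ → ℂ}

theorem orthogonal_of_coeff_eq_zero (h1 : ∀ n, (Q n).coeff n = 1)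
    (h0 : ∀ n i, n < i → (Q n).coeff i = 0)
    (hu : ∀ n m, u (Q n * Q m) = if n = m then κ n else 0) (n : ℕ) :
    ∀ f : ℂ[X], (∀ i, n ≤ i → f.coeff i = 0) → ∀ m, n ≤ m → u (Q m * f) = 0 := by
  induction n with
  | zero =>
    intro f hf m _
    have : f = 0 := by ext i; simpa using hf i (Nat.zero_le i)
    simp [this]
  | succ n ih =>
    intro f hf m hm
    have hr := ih (f - f.coeff n • Q n) (fun i hi => by
      rcases hi.eq_or_lt with rfl | hi
      · simp [h1]
      · simp [h0 n i hi, hf i hi]) m (by omega)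
    rw [mul_sub, mul_smul_comm, map_sub, map_smul, hu, if_neg (by omega)] at hr
    simpa using hr

theorem eq_zero_of_orthogonal (h1 : ∀ n, (Q n).coeff n = 1)
    (h0 : ∀ n i, n < i → (Q n).coeff i = 0) (hκ : ∀ n, κ n ≠ 0)
    (hu : ∀ n m, u (Q n * Q m) = if n = m then κ n else 0) (n : ℕ) :
    ∀ f : ℂ[X], (∀ i, n ≤ i → f.coeff i = 0) → (∀ m, m < n → u (Q m * f) = 0) → f = 0 := by
  induction n with
  | zero =>
    intro f hf _
    ext i; simpa using hf i (Nat.zero_le i)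
  | succ n ih =>
    intro f hf hm
    have hr : ∀ i, n ≤ i → (f - f.coeff n • Q n).coeff i = 0 := fun i hi => by
      rcases hi.eq_or_lt with rfl | hi
      · simp [h1]
      · simp [h0 n i hi, hf i hi]
    have hn := orthogonal_of_coeff_eq_zero h1 h0 hu n _ hr n le_rfl
    rw [mul_sub, mul_smul_comm, map_sub, map_smul, hu, if_pos rfl, hm n (by omega)] at hn
    have hc : f.coeff n = 0 := by simpa [hκ n] using hn
    refine ih f (fun i hi => by simpa [hc] using hr i hi) fun m hmn => hm m (by omega)

theorem three_term_recurrence (h1 : ∀ n, (Q n).coeff n = 1)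
    (h0 : ∀ n i, n < i → (Q n).coeff i = 0) (hκ : ∀ n, κ n ≠ 0)
    (hu : ∀ n m, u (Q n * Q m) = if n = m then κ n else 0) :
    ∃ B G : ℕ → ℂ, G 0 = 0 ∧ (∀ n, κ (n + 1) = G (n + 1) * κ n) ∧
      ∀ n, X * Q n = Q (n + 1) + B n • Q n + G n • Q (n - 1) := by
  have hX : ∀ n i, n + 2 ≤ i → (X * Q n).coeff i = 0 := fun n i hi => by
    obtain ⟨j, rfl⟩ : ∃ j, i = j + 1 := ⟨i - 1, by omega⟩
    rw [coeff_X_mul]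
    exact h0 n j (by omega)
  have hX1 : ∀ n i, n + 1 ≤ i → (X * Q n - Q (n + 1)).coeff i = 0 := fun n i hi => by
    obtain ⟨j, rfl⟩ : ∃ j, i = j + 1 := ⟨i - 1, by omega⟩
    rw [coeff_sub, coeff_X_mul]
    rcases (show n ≤ j by omega).eq_or_lt with rfl | h
    · rw [h1, h1, sub_self]
    · rw [h0 n j h, h0 (n + 1) (j + 1) (by omega), sub_self]
  -- These are the Fourier coefficients of `X * Q n`. Setting `G 0 = 0` kills the spurious term `Q
  -- (0 - 1) = Q 0`.
  refine ⟨fun n => u (Q n * (X * Q n)) / κ n, fun n => if n = 0 then 0 else κ n / κ (n - 1),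
    by simp, fun n => by simp [hκ n], fun n => ?_⟩
  rw [← sub_eq_zero]
  refine eq_zero_of_orthogonal h1 h0 hκ hu (n + 1) _ (fun i hi => ?_) fun m hm => ?_
  · have e := hX1 n i hi
    rw [coeff_sub] at e
    simp only [coeff_sub, coeff_add, coeff_smul, h0 n i (by omega), h0 (n - 1) i (by omega),
      smul_zero, add_zero, e]
  · simp only [mul_sub, mul_add, mul_smul_comm, map_sub, map_add, map_smul, hu, smul_eq_mul]
    rw [if_neg (show m ≠ n + 1 by omega)]
    rcases (show m ≤ n by omega).eq_or_lt with rfl | hmn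
    · rw [if_pos rfl, div_mul_cancel₀ _ (hκ m)]
      rcases m with _ | m <;> simp
    · rw [if_neg hmn.ne, if_neg (show n ≠ 0 by omega)]
      rcases (show m + 1 ≤ n by omega).eq_or_lt with rfl | hlt
      · have e := orthogonal_of_coeff_eq_zero h1 h0 hu (m + 1) _ (hX1 m) (m + 1) le_rfl
        rw [mul_sub, map_sub, hu, if_pos rfl] at e
        have e' : Q m * (X * Q (m + 1)) = Q (m + 1) * (X * Q m) := by ring
        rw [e', sub_eq_zero.1 e]
        simp [hκ m]
      · have e := orthogonal_of_coeff_eq_zero h1 h0 hu (m + 2) _ (hX m) n (by omega)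
        have e' : Q m * (X * Q n) = Q n * (X * Q m) := by ring
        rw [e', e, if_neg (show m ≠ n - 1 by omega)]
        simp

theorem IsOPS.exists_monic {P : ℕ → ℂ[X]} (hP : IsOPS P) :
    ∃ (k : ℕ → ℂ) (Q : ℕ → ℂ[X]) (u : ℂ[X] →ₗ[ℂ] ℂ) (κ : ℕ → ℂ),
      (∀ n, k n ≠ 0) ∧ (∀ n, P n = k n • Q n) ∧ (∀ n, (Q n).coeff n = 1) ∧
      (∀ n i, n < i → (Q n).coeff i = 0) ∧ (∀ n, κ n ≠ 0) ∧
      ∀ n m, u (Q n * Q m) = if n = m then κ n else 0 := by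
  obtain ⟨hd, u, κ, hκ, hu⟩ := hP
  have hk : ∀ n, (P n).coeff n ≠ 0 := fun n => coeff_ne_zero_of_eq_degree (hd n)
  refine ⟨fun n => (P n).coeff n, fun n => ((P n).coeff n)⁻¹ • P n, u,
    fun n => ((P n).coeff n)⁻¹ * ((P n).coeff n)⁻¹ * κ n, hk, fun n => ?_, fun n => ?_,
    fun n i hi => ?_, fun n => ?_, fun n m => ?_⟩
  · simp [smul_smul, hk n]
  · simp [hk n]
  · have hi' : (P n).coeff i = 0 :=
      coeff_eq_zero_of_degree_lt (by rw [hd]; exact_mod_cast hi)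
    rw [coeff_smul, hi', smul_zero]
  · simp [hk n, hκ n]
  · rw [smul_mul_assoc, mul_smul_comm, map_smul, map_smul, hu]
    split_ifs with h
    · subst h; simp [mul_assoc]
    · simp

end Orthogonality

/-! ### Recurrences from a tridiagonal skew form -/

section Tridiagonal

variable {Q : ℕ → ℂ[X]} {B G : ℕ → ℂ} {A : ℂ[X] →ₗ[ℂ] ℂ[X] →ₗ[ℂ] ℂ} {k K : ℂ}

theorem X_mul_X_mul_eq (hG : G 0 = 0)
    (hX : ∀ n, X * Q n = Q (n + 1) + B n • Q n + G n • Q (n - 1)) (n : ℕ) :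
    X ^ 2 * Q n = Q (n + 2) + (B (n + 1) + B n) • Q (n + 1)
      + (G (n + 1) + B n ^ 2 + G n) • Q n + (G n * (B n + B (n - 1))) • Q (n - 1)
      + (G n * G (n - 1)) • Q (n - 2) := by
  have hX' : ∀ n, X * Q (n + 1) = Q (n + 2) + B (n + 1) • Q (n + 1) + G (n + 1) • Q n :=
    fun n => hX (n + 1)
  have h0 : X * Q 0 = Q 1 + B 0 • Q 0 := by simpa [hG] using hX 0
  rcases n with _ | n
  · rw [sq, mul_assoc, h0, mul_add, mul_smul_comm, hX', h0]
    simp only [hG]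
    module
  · rw [sq, mul_assoc, hX', mul_add, mul_add, mul_smul_comm, mul_smul_comm, hX', hX', hX n]
    simp only [show n + 1 - 1 = n from rfl, show n + 1 - 2 = n - 1 from rfl]
    module

/-- The identity `hA2` is expanded at the pairs `(Q (n+3), Q n)`, `(Q (n+2), Q n)` and `(Q (n+1), Q
n)`; tridiagonality and skewness leave only the entries `D`. -/
theorem tridiagonal_recurrences (hG : G 0 = 0)
    (hX : ∀ n, X * Q n = Q (n + 1) + B n • Q n + G n • Q (n - 1))
    (hA : ∀ f g, A f g = -A g f) (hA0 : ∀ m n, n + 2 ≤ m → A (Q m) (Q n) = 0)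
    (hA2 : ∀ f g, A (X ^ 2 * f) g - k * A (X * f) (X * g) + A f (X ^ 2 * g) - K * A f g = 0)
    {D : ℕ → ℂ} (hD : ∀ n, D n = A (Q (n + 1)) (Q n)) (n : ℕ) :
    (G (n + 3) * G (n + 2) * D n - k * (G (n + 3) * D (n + 1)) + D (n + 2) = 0) ∧
    (G (n + 2) * D n * (B (n + 2) + B (n + 1)) + D (n + 1) * (B (n + 1) + B n) =
      k * (D (n + 1) * B (n + 2) + G (n + 2) * D n * B n)) ∧
    (D n * (G (n + 2) + 2 * G (n + 1) + B (n + 1) ^ 2 + B n ^ 2 + G n)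
        - G (n + 1) * G n * D (n - 1) - D (n + 1) - K * D n =
      k * (D (n + 1) + B n * B (n + 1) * D n - G (n + 1) * D n + G (n + 1) * G n * D (n - 1))) := by
  have hX' : ∀ n, X * Q (n + 1) = Q (n + 2) + B (n + 1) • Q (n + 1) + G (n + 1) • Q n :=
    fun n => hX (n + 1)
  have hs : ∀ m, A (Q m) (Q m) = 0 := fun m => by
    have := hA (Q m) (Q m); linear_combination this / 2
  have hu1 : ∀ m, A (Q m) (Q (m + 1)) = -D m := fun m => by rw [hA, hD]
  have hl1 : ∀ m, A (Q (m + 1)) (Q m) = D m := fun m => (hD m).symm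
  have z : ∀ i j, n + 2 ≤ i → j ≤ n → A (Q i) (Q j) = 0 := fun i j hi hj => hA0 _ _ (by omega)
  -- For `n = 0` the entry is `A (Q 1) (Q 0)`, not known to vanish; the factor `G 0 = 0` is what
  -- counts.
  have z1 : G n * A (Q (n + 1)) (Q (n - 1)) = 0 := by
    rcases n with _ | n
    · simp [hG]
    · rw [hA0 _ _ (by omega), mul_zero]
  have z1' : G n * A (Q (n + 1)) (Q (n - 2)) = 0 := by
    rcases n with _ | n
    · simp [hG]
    · rw [hA0 _ _ (by omega), mul_zero]
  have y1 : G n * A (Q n) (Q (n - 1)) = G n * D (n - 1) := by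
    rcases n with _ | n
    · simp [hG]
    · rw [hD]; rfl
  have y1' : G n * A (Q (n - 1)) (Q n) = -(G n * D (n - 1)) := by
    rw [hA, ← y1]; ring
  have xx := X_mul_X_mul_eq hG hX n
  refine ⟨?_, ?_, ?_⟩
  · have e := hA2 (Q (n + 3)) (Q n)
    have xx' : X ^ 2 * Q (n + 3) = Q (n + 5) + (B (n + 4) + B (n + 3)) • Q (n + 4)
      + (G (n + 4) + B (n + 3) ^ 2 + G (n + 3)) • Q (n + 3)
      + (G (n + 3) * (B (n + 3) + B (n + 2))) • Q (n + 2)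
      + (G (n + 3) * G (n + 2)) • Q (n + 1) := X_mul_X_mul_eq hG hX (n + 3)
    have x' : X * Q (n + 3) = Q (n + 4) + B (n + 3) • Q (n + 3) + G (n + 3) • Q (n + 2) :=
      hX (n + 3)
    rw [xx, xx', x', hX n] at e
    simp only [map_add, map_smul, LinearMap.add_apply, LinearMap.smul_apply, smul_eq_mul] at e
    rw [z (n + 5) n (by omega) (by omega), z (n + 4) n (by omega) (by omega),
      z (n + 3) n (by omega) (by omega), z (n + 2) n (by omega) (by omega), hl1 n,
      hA0 (n + 4) (n + 1) (by omega), hA0 (n + 3) (n + 1) (by omega),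
      z (n + 4) (n - 1) (by omega) (by omega), z (n + 3) (n - 1) (by omega) (by omega),
      z (n + 2) (n - 1) (by omega) (by omega), z (n + 3) (n - 2) (by omega) (by omega),
      show A (Q (n + 2)) (Q (n + 1)) = _ from hl1 (n + 1),
      show A (Q (n + 3)) (Q (n + 2)) = _ from hl1 (n + 2)] at e
    linear_combination e
  · have e := hA2 (Q (n + 2)) (Q n)
    have xx' : X ^ 2 * Q (n + 2) = Q (n + 4) + (B (n + 3) + B (n + 2)) • Q (n + 3)
      + (G (n + 3) + B (n + 2) ^ 2 + G (n + 2)) • Q (n + 2)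
      + (G (n + 2) * (B (n + 2) + B (n + 1))) • Q (n + 1)
      + (G (n + 2) * G (n + 1)) • Q n := X_mul_X_mul_eq hG hX (n + 2)
    have x' : X * Q (n + 2) = Q (n + 3) + B (n + 2) • Q (n + 2) + G (n + 2) • Q (n + 1) :=
      hX (n + 2)
    rw [xx, xx', x', hX n] at e
    simp only [map_add, map_smul, LinearMap.add_apply, LinearMap.smul_apply, smul_eq_mul] at e
    rw [z (n + 4) n (by omega) (by omega),
      z (n + 3) n (by omega) (by omega), z (n + 2) n (by omega) (by omega), hl1 n, hs n,
      hA0 (n + 3) (n + 1) (by omega), hs (n + 1), hs (n + 2),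
      z (n + 3) (n - 1) (by omega) (by omega),
      z (n + 2) (n - 1) (by omega) (by omega), z (n + 2) (n - 2) (by omega) (by omega),
      show A (Q (n + 2)) (Q (n + 1)) = _ from hl1 (n + 1)] at e
    linear_combination e + k * G (n + 2) * z1
  · have e := hA2 (Q (n + 1)) (Q n)
    have xx' : X ^ 2 * Q (n + 1) = Q (n + 3) + (B (n + 2) + B (n + 1)) • Q (n + 2)
      + (G (n + 2) + B (n + 1) ^ 2 + G (n + 1)) • Q (n + 1)
      + (G (n + 1) * (B (n + 1) + B n)) • Q n
      + (G (n + 1) * G n) • Q (n - 1) := X_mul_X_mul_eq hG hX (n + 1)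
    rw [xx, xx', hX' n, hX n] at e
    simp only [map_add, map_smul, LinearMap.add_apply, LinearMap.smul_apply, smul_eq_mul] at e
    rw [z (n + 3) n (by omega) (by omega), z (n + 2) n (by omega) (by omega), hl1 n, hs n,
      hs (n + 1), hu1 (n + 1), hu1 n,
      z (n + 2) (n - 1) (by omega) (by omega),
      show A (Q (n + 2)) (Q (n + 1)) = _ from hl1 (n + 1)] at e
    linear_combination e + k * B (n + 1) * z1 + k * G (n + 1) * y1 - G (n + 1) * y1'
      - (B n + B (n - 1)) * z1 - G (n - 1) * z1'

end Tridiagonal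

/-! ### Symmetric form of the Askey-Wilson coefficients -/

/-- The off-diagonal `e₀ / s - e₄ s` of the antisymmetric part of the structure relation,
with `s = q ^ n`. -/
def offDiag (E : Fin 5 → ℂ) (s : ℂ) : ℂ := E 0 / s - E 4 * s

/-- `offDiag E s + offDiag E (s / q)`, divided by `1 + q`. -/
def offDiagMid (q : ℂ) (E : Fin 5 → ℂ) (s : ℂ) : ℂ := E 0 / s - E 4 * s / q

/-- Numerator of the recurrence coefficient `B_n`. -/
def symmBNum (q : ℂ) (E : Fin 5 → ℂ) (s : ℂ) : ℂ :=
  ((E 0 / s + E 4 * s / q) * (q * E 1 + E 3) - (1 + q) / q * (E 4 * E 1 + q * E 0 * E 3)) / 2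

/-- Homogeneous resolvent cubic of the quartic `e₀ x⁴ - e₁ x³ + e₂ x² - e₃ x + e₄`. -/
def resolventCubic (E : Fin 5 → ℂ) (y : ℂ) : ℂ :=
  y ^ 3 - E 2 * y ^ 2 + (E 1 * E 3 - 4 * E 0 * E 4) * y
    - (E 0 * E 3 ^ 2 + E 1 ^ 2 * E 4 - 4 * E 0 * E 2 * E 4)

/-- The coefficient `B_n` of the monic Askey-Wilson polynomials whose parameters are the roots of
`e₀ x⁴ - e₁ x³ + e₂ x² - e₃ x + e₄`. -/
def symmB (q : ℂ) (E : Fin 5 → ℂ) (n : ℕ) : ℂ :=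
  -- The general formula is `0 / 0` at `n = 0` when `e₄ = q² e₀`; the common factor `offDiag E (1 /
  -- q)` is cancelled here.
  if n = 0 then (E 1 - E 3) / (2 * (E 0 - E 4))
  else symmBNum q E (q ^ n) / (offDiag E (q ^ n) * offDiag E (q ^ n / q))

/-- The coefficient `C_{n+1}` of the monic Askey-Wilson polynomials whose parameters are the roots
of `e₀ x⁴ - e₁ x³ + e₂ x² - e₃ x + e₄`. -/
def symmCSucc (q : ℂ) (E : Fin 5 → ℂ) (n : ℕ) : ℂ :=
  -- Likewise with the common factor `e₀ - e₄ / q` cancelled.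
  if n = 0 then (1 - q) * resolventCubic E (E 0 + E 4) / (4 * q * offDiagMid q E q * (E 0 - E 4) ^ 2)
  else (1 - q * q ^ n) * (E 0 - E 4 * q ^ n / q) * resolventCubic E (E 0 / q ^ n + E 4 * q ^ n) /
    (4 * q * q ^ n * offDiagMid q E (q ^ n) * offDiagMid q E (q * q ^ n) * offDiag E (q ^ n) ^ 2)

set_option maxRecDepth 4000 in
-- Multiplying `hV` by `offDiagMid q E t` expresses `G'` through the known closed form of `G`; what
-- remains is a rational identity in `q`, `t` and the `e_i`.
theorem coeffC_step {q t : ℂ} {E : Fin 5 → ℂ} (hq : q ≠ 0) (ht : t ≠ 0)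
    (h₁ : offDiag E t ≠ 0) (h₂ : offDiag E (t / q) ≠ 0) {G G' b : ℂ}
    (hb : offDiag E t * offDiag E (t / q) * b = symmBNum q E t)
    (hG : G * offDiagMid q E (t / q) * offDiagMid q E t * offDiag E (t / q) ^ 2 =
      (1 - t) * (E 0 - E 4 * t / q ^ 2) * resolventCubic E (E 0 * q / t + E 4 * t / q) / (4 * t))
    (hV : (1 + q) * (G' * offDiagMid q E (q * t) - G * offDiagMid q E (t / q)) =
      (1 - q) / (2 * q) * (q * E 1 + E 3) * b - (offDiag E t - offDiag E (t / q)) * b ^ 2 +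
        (1 - q ^ 2) / (4 * q) * (-E 2 - q * E 0 - E 4 / q + (1 + q) * (E 0 / t + E 4 * t / q)))
    (hq1 : 1 + q ≠ 0) :
    G' * offDiagMid q E t * offDiagMid q E (q * t) * offDiag E t ^ 2 =
      (1 - q * t) * (E 0 - E 4 * t / q) * resolventCubic E (E 0 / t + E 4 * t) / (4 * q * t) := by
  have hb' : b = symmBNum q E t / (offDiag E t * offDiag E (t / q)) := by
    rw [eq_div_iff (mul_ne_zero h₁ h₂)]; linear_combination hb
  have hG' : G * offDiagMid q E (t / q) * offDiagMid q E t = (1 - t) * (E 0 - E 4 * t / q ^ 2)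
      * resolventCubic E (E 0 * q / t + E 4 * t / q) / (4 * t) / offDiag E (t / q) ^ 2 := by
    rw [eq_div_iff (pow_ne_zero 2 h₂)]; exact hG
  have key : (1 + q) * (G' * offDiagMid q E t * offDiagMid q E (q * t) * offDiag E t ^ 2) =
      ((1 + q) * (G * offDiagMid q E (t / q) * offDiagMid q E t) +
      offDiagMid q E t * ((1 - q) / (2 * q) * (q * E 1 + E 3) * b
        - (offDiag E t - offDiag E (t / q)) * b ^ 2 +
        (1 - q ^ 2) / (4 * q) * (-E 2 - q * E 0 - E 4 / q + (1 + q) * (E 0 / t + E 4 * t / q))))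
          * offDiag E t ^ 2 := by
    linear_combination offDiagMid q E t * offDiag E t ^ 2 * hV
  apply mul_left_cancel₀ hq1
  rw [key, hG']
  clear key hV hb hG hG'
  subst hb'
  -- Opaque names keep the two denominators atomic while fractions are cleared.
  obtain ⟨M, hM⟩ : ∃ M, M = E 0 - E 4 * t ^ 2 := ⟨_, rfl⟩
  obtain ⟨N, hN⟩ : ∃ N, N = E 0 * q ^ 2 - E 4 * t ^ 2 := ⟨_, rfl⟩
  have e₁ : offDiag E t = M / t := by simp only [offDiag, hM]; field_simp
  have e₂ : offDiag E (t / q) = N / (q * t) := by simp only [offDiag, hN]; field_simp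
  rw [e₁] at h₁ ⊢
  rw [e₂] at h₂ ⊢
  have n₁ := (div_ne_zero_iff.1 h₁).1
  have n₂ := (div_ne_zero_iff.1 h₂).1
  simp only [symmBNum, resolventCubic, offDiagMid]
  generalize E 0 = e0 at *
  generalize E 1 = e1 at *
  generalize E 2 = e2 at *
  generalize E 3 = e3 at *
  generalize E 4 = e4 at *
  field_simp
  rw [hM, hN]
  ring

/-! ### Solving the recurrences -/

section Solve

variable {q : ℂ} {E : Fin 5 → ℂ} {d B G : ℕ → ℂ}

theorem add_inv_mul_offDiag (hq : q ≠ 0) {s : ℂ} (hs : s ≠ 0) :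
    (q + q⁻¹) * offDiag E s = offDiag E (s / q) + offDiag E (q * s) := by
  simp only [offDiag]; field_simp; ring

theorem offDiag_add_offDiag (hq : q ≠ 0) {s : ℂ} (hs : s ≠ 0) :
    offDiag E s + offDiag E (s / q) = (1 + q) * offDiagMid q E s := by
  simp only [offDiag, offDiagMid]; field_simp; ring

theorem exists_eq_offDiag (hq : q ≠ 0) (hq2 : q ^ 2 ≠ 1)
    (h : ∀ n, d n - (q + q⁻¹) * d (n + 1) + d (n + 2) = 0) :
    ∃ e₀ e₄ : ℂ, ∀ n, d n = e₀ / q ^ n - e₄ * q ^ n := by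
  have hq2' : 1 - q ^ 2 ≠ 0 := sub_ne_zero.2 hq2.symm
  refine ⟨d 0 + (d 0 - q * d 1) / (q ^ 2 - 1), (d 0 - q * d 1) / (q ^ 2 - 1), fun n => ?_⟩
  have hq3 : q ^ 2 - 1 ≠ 0 := sub_ne_zero.2 hq2
  induction n using Nat.twoStepInduction with
  | zero => simp
  | one => field_simp; ring
  | more n h₀ h₁ =>
    rw [show d (n + 2) = (q + q⁻¹) * d (n + 1) - d n by linear_combination h n, h₁, h₀]
    have := pow_ne_zero n hq
    simp only [pow_succ]
    field_simp
    ring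

/-- Replacing `(q + q⁻¹) d_n` by `d_{n-1} + d_{n+1}` in `h₂` shows that the left side does not
depend on `n`. -/
theorem linear_recurrence_B (hq : q ≠ 0) (hd : ∀ n, d n = offDiag E (q ^ n))
    (h₂ : ∀ n, d n * (B (n + 2) + B (n + 1)) + d (n + 1) * (B (n + 1) + B n) =
      (q + q⁻¹) * (d (n + 1) * B (n + 2) + d n * B n))
    (hW : offDiag E q * B 1 - offDiag E (1 / q) * B 0 = (1 - q) / (2 * q) * (q * E 1 + E 3))
    (n : ℕ) : offDiag E (q * q ^ n) * B (n + 1) - offDiag E (q ^ n / q) * B n =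
      (1 - q) / (2 * q) * (q * E 1 + E 3) := by
  induction n with
  | zero => simpa using hW
  | succ n ih =>
    have hs := pow_ne_zero n hq
    have e := h₂ n
    rw [hd, hd, pow_succ'] at e
    have a₁ := add_inv_mul_offDiag (E := E) hq hs
    have a₂ := add_inv_mul_offDiag (E := E) hq (mul_ne_zero hq hs)
    rw [mul_div_cancel_left₀ _ hq] at a₂
    rw [pow_succ', mul_div_cancel_left₀ _ hq, show n + 1 + 1 = n + 2 from rfl]
    linear_combination ih - e - B (n + 2) * a₂ - B n * a₁

/-- The factor `offDiag E (q ^ n)` is integrating: multiplied by it, `hW` telescopes, and `symmBNum`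
has the same increments. -/
theorem offDiag_mul_B (hq : q ≠ 0) (hB0 : 2 * (E 0 - E 4) * B 0 = E 1 - E 3)
    (hW : ∀ n, offDiag E (q * q ^ n) * B (n + 1) - offDiag E (q ^ n / q) * B n =
      (1 - q) / (2 * q) * (q * E 1 + E 3)) (n : ℕ) :
    offDiag E (q ^ n) * offDiag E (q ^ n / q) * B n = symmBNum q E (q ^ n) := by
  induction n with
  | zero =>
    have e : E 1 = E 3 + 2 * (E 0 - E 4) * B 0 := by linear_combination -hB0
    simp only [pow_zero, offDiag, symmBNum, e]
    field_simp
    ring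
  | succ n ih =>
    have hs := pow_ne_zero n hq
    have e : symmBNum q E (q * q ^ n) = symmBNum q E (q ^ n)
        + (1 - q) / (2 * q) * (q * E 1 + E 3) * offDiag E (q ^ n) := by
      simp only [symmBNum, offDiag]; field_simp; ring
    rw [pow_succ', mul_div_cancel_left₀ _ hq, e]
    linear_combination offDiag E (q ^ n) * hW n + ih

/-- The telescoping quantity in the recurrence for the `C_n`. -/
def potential (q : ℂ) (E : Fin 5 → ℂ) (s b : ℂ) : ℂ :=
  (1 - q) / (2 * q) * (q * E 1 + E 3) * b - (offDiag E s - offDiag E (s / q)) * b ^ 2 +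
    (1 - q ^ 2) / (4 * q) * (-E 2 - q * E 0 - E 4 / q + (1 + q) * (E 0 / s + E 4 * s / q))

/-- Subtracting `(B_{n+1} - B_n)` times `hW` from `h₁` removes the mixed terms `B_n B_{n+1}` and
leaves `(d_{n+1} - d_n) B_{n+1}² - (d_n - d_{n-1}) B_n²`, so that everything telescopes. The start
`n = 0` is the normalization `hG1`. -/
theorem difference_C_eq_potential (hq : q ≠ 0) (hd : ∀ n, d n = offDiag E (q ^ n))
    (hd0 : E 0 - E 4 ≠ 0) (hG0 : G 0 = 0)
    (h₁ : ∀ n, d n * (G (n + 2) + 2 * G (n + 1) + B (n + 1) ^ 2 + B n ^ 2 + G n)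
        - G n * d (n - 1) - G (n + 2) * d (n + 1) - (1 - (q + q⁻¹) ^ 2 / 4) * d n =
      (q + q⁻¹) * (d (n + 1) * G (n + 2) + B n * B (n + 1) * d n - G (n + 1) * d n
        + G n * d (n - 1)))
    (hB0 : 2 * (E 0 - E 4) * B 0 = E 1 - E 3)
    (hW : ∀ n, offDiag E (q * q ^ n) * B (n + 1) - offDiag E (q ^ n / q) * B n =
      (1 - q) / (2 * q) * (q * E 1 + E 3))
    (hG1 : 4 * q * (E 0 - E 4) ^ 2 * offDiagMid q E q * G 1 =
      (1 - q) * resolventCubic E (E 0 + E 4)) (n : ℕ) :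
    (1 + q) * (G (n + 1) * offDiagMid q E (q * q ^ n) - G n * offDiagMid q E (q ^ n / q)) =
      potential q E (q ^ n) (B n) := by
  induction n with
  | zero =>
    have e : E 1 = E 3 + 2 * (E 0 - E 4) * B 0 := by linear_combination -hB0
    have e₁ : offDiagMid q E q * G 1 =
        (1 - q) * resolventCubic E (E 0 + E 4) / (4 * q * (E 0 - E 4) ^ 2) := by
      rw [eq_div_iff (by simp [hq, hd0])]; linear_combination hG1
    have e₂ : resolventCubic E (E 0 + E 4) = (E 0 - E 4) ^ 2 * (E 0 + E 4 - E 2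
        + 2 * B 0 * (E 0 * E 3 - E 1 * E 4) / (E 0 - E 4)) := by
      rw [e]; simp only [resolventCubic, e]; field_simp; ring
    have e₃ : offDiagMid q E q * G 1 = (1 - q) / (4 * q) * (E 0 + E 4 - E 2
        + 2 * B 0 * (E 3 - 2 * B 0 * E 4)) := by
      rw [e₁, e₂, e]; field_simp; ring
    simp only [pow_zero, mul_one, hG0, zero_mul, sub_zero, zero_add, potential]
    rw [mul_comm (G 1), e₃]
    simp only [offDiag, e]
    field_simp
    ring
  | succ n ih =>
    have hs := pow_ne_zero n hq
    have e := h₁ n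
    have eG : G n * d (n - 1) = G n * offDiag E (q ^ n / q) := by
      rcases n with _ | n
      · simp [hG0]
      · rw [hd, pow_succ, mul_div_cancel_right₀ _ hq]; rfl
    rw [eG, hd, hd, pow_succ' q n] at e
    have w := hW n
    have a₁ := add_inv_mul_offDiag (E := E) hq hs
    have g₀ := offDiag_add_offDiag (E := E) hq hs
    have g₁ := offDiag_add_offDiag (E := E) hq (mul_ne_zero hq hs)
    have g₂ := offDiag_add_offDiag (E := E) hq (mul_ne_zero hq (mul_ne_zero hq hs))
    have gm := offDiag_add_offDiag (E := E) hq (div_ne_zero hs hq)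
    have a₀ := add_inv_mul_offDiag (E := E) hq (div_ne_zero hs hq)
    have a₂ := add_inv_mul_offDiag (E := E) hq (mul_ne_zero hq hs)
    rw [mul_div_cancel_left₀ _ hq] at g₁ g₂ a₂
    rw [mul_div_cancel₀ _ hq] at a₀
    have hK : (1 - q ^ 2) / (4 * q) * ((1 + q) * (E 0 / (q * q ^ n) + E 4 * (q * q ^ n) / q))
        - (1 - q ^ 2) / (4 * q) * ((1 + q) * (E 0 / (q ^ n) + E 4 * (q ^ n) / q)) =
        -(1 - (q + q⁻¹) ^ 2 / 4) * offDiag E (q ^ n) := by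
      simp only [offDiag]; field_simp; ring
    rw [pow_succ', mul_div_cancel_left₀ _ hq, show n + 1 + 1 = n + 2 from rfl]
    simp only [potential] at ih ⊢
    rw [mul_div_cancel_left₀ _ hq]
    linear_combination ih + G (n + 1) * g₁ - G n * gm - G (n + 2) * g₂ + G (n + 1) * g₀
      - (e + G (n + 2) * a₂ + B n * B (n + 1) * a₁ - G (n + 1) * a₁ + G n * a₀)
      + (B (n + 1) - B n) * w - hK

theorem sum_potential (hq : q ≠ 0) (hG0 : G 0 = 0)
    (hV : ∀ n, (1 + q) * (G (n + 1) * offDiagMid q E (q * q ^ n)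
      - G n * offDiagMid q E (q ^ n / q)) = potential q E (q ^ n) (B n)) (n : ℕ) :
    (1 + q) * (G n * offDiagMid q E (q ^ n) * offDiagMid q E (q ^ n / q)) =
      ∑ k ∈ Finset.range n, potential q E (q ^ k) (B k) * offDiagMid q E (q ^ k) := by
  induction n with
  | zero => simp [hG0]
  | succ n ih =>
    rw [Finset.sum_range_succ, ← ih, ← hV, pow_succ', mul_div_cancel_left₀ _ hq]
    ring

/-- If `e₀ = e₄ p`, then `offDiag E` is odd under `s ↦ p / s`; the reflection `s ↦ q p / s` adds a
shift by `q`. -/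
theorem offDiag_reflect (hq : q ≠ 0) {p s t : ℂ} (hs : s ≠ 0) (ht : t ≠ 0) (hst : s * t = q * p)
    (hp : E 0 = E 4 * p) :
    offDiag E t = -offDiag E (s / q) ∧ offDiag E (t / q) = -offDiag E s ∧
      offDiagMid q E t = -offDiagMid q E s ∧
      E 0 / t + E 4 * t / q = E 0 / s + E 4 * s / q := by
  have hp' : E 0 = E 4 * (s * t / q) := by rw [hst, hp]; field_simp
  simp only [offDiag, offDiagMid, hp']
  refine ⟨?_, ?_, ?_, ?_⟩ <;> field_simp <;> ring

/-- The potential is quadratic in `b` with reflection-invariant coefficients, so the difference of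
its values factors as in `main`. Either `B i = B j`, or an off-diagonal entry vanishes. -/
theorem potential_reflect (hq : q ≠ 0) (hinj : Function.Injective fun n : ℕ => q ^ n)
    (hW : ∀ n, offDiag E (q * q ^ n) * B (n + 1) - offDiag E (q ^ n / q) * B n =
      (1 - q) / (2 * q) * (q * E 1 + E 3))
    (hb : ∀ n, offDiag E (q ^ n) * offDiag E (q ^ n / q) * B n = symmBNum q E (q ^ n))
    {m : ℕ} (hm : E 0 = E 4 * q ^ m) (h4 : E 4 ≠ 0) {i j : ℕ} (hij : i + j = m + 1) :
    potential q E (q ^ j) (B j) = potential q E (q ^ i) (B i) := by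
  have hi := pow_ne_zero i hq
  have hj := pow_ne_zero j hq
  have hst : q ^ i * q ^ j = q * q ^ m := by rw [← pow_add, hij, pow_succ']
  obtain ⟨r₁, r₂, -, r₄⟩ := offDiag_reflect (E := E) hq hi hj hst hm
  have hbi := hb i
  have hbj := hb j
  have hs : symmBNum q E (q ^ j) = symmBNum q E (q ^ i) := by simp only [symmBNum, r₄]
  have main : (B i - B j) * ((1 - q) / (2 * q) * (q * E 1 + E 3)
      - (offDiag E (q ^ i) - offDiag E (q ^ i / q)) * (B i + B j)) = 0 := by
    have hz : offDiag E (q ^ i) * offDiag E (q ^ i / q) * (B i - B j) = 0 := by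
      rw [r₁, r₂, hs] at hbj
      linear_combination hbi - hbj
    have hst' : E 0 = E 4 * (q ^ i * q ^ j / q) := by rw [hst, hm]; field_simp
    rcases mul_eq_zero.1 hz with hz | hz
    · rcases mul_eq_zero.1 hz with h₀ | h₀
      -- A vanishing entry forces the two indices to be adjacent, and then `hW` makes the second
      -- factor of `main` zero.
      · have e : q ^ j = q ^ (i + 1) := by
          rw [offDiag, hst'] at h₀
          field_simp at h₀
          rw [mul_zero] at h₀
          rw [pow_succ]
          have := (mul_eq_zero.1 h₀).resolve_left h4
          linear_combination this
        obtain rfl := hinj e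
        have w := hW i
        rw [← pow_succ', r₁] at w
        rw [h₀]
        linear_combination -(B i - B (i + 1)) * w
      · have e : q ^ i = q ^ (j + 1) := by
          rw [offDiag, hst'] at h₀
          field_simp at h₀
          rw [mul_zero] at h₀
          rw [pow_succ]
          have := (mul_eq_zero.1 h₀).resolve_left h4
          linear_combination -this
        obtain rfl := hinj e
        have w := hW j
        rw [← pow_succ', r₂] at w
        rw [h₀]
        linear_combination -(B (j + 1) - B j) * w
    · rw [hz, zero_mul]
  simp only [potential, r₁, r₂, r₄]
  linear_combination -main

/-- If `e₀ = e₄ qᵐ`, reflection `k ↦ m + 1 - k` preserves the potential and changes the sign of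
`offDiagMid`, so the sum in `sum_potential` up to `m + 1` vanishes. Its other side is `G (m + 2)`
times nonzero factors. -/
theorem ne_mul_pow (hq : q ≠ 0) (hinj : Function.Injective fun n : ℕ => q ^ n)
    (hq1 : 1 + q ≠ 0) (hd0 : E 0 - E 4 ≠ 0) (hG0 : G 0 = 0) (hG : ∀ n, G (n + 1) ≠ 0)
    (hW : ∀ n, offDiag E (q * q ^ n) * B (n + 1) - offDiag E (q ^ n / q) * B n =
      (1 - q) / (2 * q) * (q * E 1 + E 3))
    (hb : ∀ n, offDiag E (q ^ n) * offDiag E (q ^ n / q) * B n = symmBNum q E (q ^ n))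
    (hV : ∀ n, (1 + q) * (G (n + 1) * offDiagMid q E (q * q ^ n)
      - G n * offDiagMid q E (q ^ n / q)) = potential q E (q ^ n) (B n)) (m : ℕ) :
    E 0 - E 4 * q ^ m ≠ 0 := by
  intro h
  have hm : E 0 = E 4 * q ^ m := sub_eq_zero.1 h
  have h4 : E 4 ≠ 0 := by
    intro h4
    rw [h4] at hm
    simp [hm, h4] at hd0
  have hs := sum_potential hq hG0 hV (m + 2)
  have h0 : ∑ k ∈ Finset.range (m + 2), potential q E (q ^ k) (B k) * offDiagMid q E (q ^ k) =
      0 := by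
    rw [← self_eq_neg, ← Finset.sum_neg_distrib]
    conv_lhs => rw [← Finset.sum_range_reflect]
    refine Finset.sum_congr rfl fun k hk => ?_
    have hk' : k + (m + 2 - 1 - k) = m + 1 := by
      have := Finset.mem_range.1 hk
      omega
    have hst : q ^ k * q ^ (m + 2 - 1 - k) = q * q ^ m := by
      rw [← pow_add, hk', pow_succ']
    rw [potential_reflect hq hinj hW hb hm h4 hk',
      (offDiag_reflect (E := E) hq (pow_ne_zero k hq) (pow_ne_zero _ hq) hst hm).2.2.1]
    ring
  have hqm := pow_ne_zero m hq
  have hne : ∀ n : ℕ, n ≠ 0 → 1 - q ^ n ≠ 0 := fun n hn h =>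
    hn (hinj (by simpa using (sub_eq_zero.1 h).symm))
  have g₁ : offDiagMid q E (q ^ (m + 2)) = E 4 * (1 - q ^ (m + 3)) / q ^ 2 := by
    simp only [offDiagMid, hm, pow_add]; field_simp
  have g₂ : offDiagMid q E (q ^ (m + 2) / q) = E 4 * (1 - q ^ (m + 1)) / q := by
    simp only [offDiagMid, hm, pow_add]; field_simp
  rw [h0, g₁, g₂] at hs
  refine mul_ne_zero hq1 (mul_ne_zero (mul_ne_zero (hG (m + 1)) ?_) ?_) hs
  · exact div_ne_zero (mul_ne_zero h4 (hne _ (by omega))) (pow_ne_zero _ hq)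
  · exact div_ne_zero (mul_ne_zero h4 (hne _ (by omega))) hq

theorem offDiag_pow_ne_zero (hq : q ≠ 0) (h : ∀ n : ℕ, E 0 - E 4 * q ^ n ≠ 0) (n : ℕ) :
    offDiag E (q ^ n) ≠ 0 := by
  have e : offDiag E (q ^ n) = (E 0 - E 4 * q ^ (2 * n)) / q ^ n := by
    rw [offDiag, two_mul, pow_add]
    have := pow_ne_zero n hq
    field_simp
  rw [e]
  exact div_ne_zero (h _) (pow_ne_zero _ hq)

theorem offDiagMid_pow_ne_zero (hq : q ≠ 0) (h : ∀ n : ℕ, E 0 - E 4 * q ^ n ≠ 0) (n : ℕ) :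
    offDiagMid q E (q * q ^ n) ≠ 0 := by
  have e : offDiagMid q E (q * q ^ n) = (E 0 - E 4 * q ^ (2 * n + 1)) / (q * q ^ n) := by
    rw [offDiagMid, two_mul, pow_succ, pow_add]
    have := pow_ne_zero n hq
    field_simp
  rw [e]
  exact div_ne_zero (h _) (mul_ne_zero hq (pow_ne_zero _ hq))

theorem coeffC_eq (hq : q ≠ 0) (hq1 : 1 + q ≠ 0) (hE : ∀ n : ℕ, E 0 - E 4 * q ^ n ≠ 0)
    (hb : ∀ n, offDiag E (q ^ n) * offDiag E (q ^ n / q) * B n = symmBNum q E (q ^ n))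
    (hG1 : 4 * q * (E 0 - E 4) ^ 2 * offDiagMid q E q * G 1 =
      (1 - q) * resolventCubic E (E 0 + E 4))
    (hV : ∀ n, (1 + q) * (G (n + 1) * offDiagMid q E (q * q ^ n)
      - G n * offDiagMid q E (q ^ n / q)) = potential q E (q ^ n) (B n)) (n : ℕ) :
    G (n + 1) * offDiagMid q E (q ^ n) * offDiagMid q E (q * q ^ n) * offDiag E (q ^ n) ^ 2 =
      (1 - q * q ^ n) * (E 0 - E 4 * q ^ n / q) * resolventCubic E (E 0 / q ^ n + E 4 * q ^ n)
        / (4 * q * q ^ n) := by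
  induction n with
  | zero =>
    have e : offDiagMid q E 1 = E 0 - E 4 / q := by simp [offDiagMid]
    have e' : offDiag E 1 = E 0 - E 4 := by simp [offDiag]
    simp only [pow_zero, mul_one, div_one, e, e', zero_add]
    rw [eq_div_iff (by simp [hq])]
    linear_combination (E 0 - E 4 / q) * hG1
  | succ n ih =>
    have hs := pow_ne_zero n hq
    rw [pow_succ']
    have hn := offDiag_pow_ne_zero hq hE (n + 1)
    have hn' := offDiag_pow_ne_zero hq hE n
    have hbn := hb (n + 1)
    have hVn := hV (n + 1)
    rw [pow_succ'] at hn hbn hVn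
    have hc : q * q ^ n / q = q ^ n := mul_div_cancel_left₀ _ hq
    refine coeffC_step (b := B (n + 1)) (G := G (n + 1)) hq (mul_ne_zero hq hs) hn ?_ hbn ?_
      hVn hq1
    · rwa [hc]
    · rw [hc, ih]
      have e₁ : q * q ^ n / q ^ 2 = q ^ n / q := by field_simp
      have e₂ : E 0 * q / (q * q ^ n) + E 4 * (q * q ^ n) / q = E 0 / q ^ n + E 4 * q ^ n := by
        field_simp
      rw [mul_div_assoc (E 4) (q * q ^ n) (q ^ 2), e₁, e₂, mul_div_assoc (E 4), mul_assoc 4 q]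

end Solve

/-- The pair `e₀, e₄` comes from `d`, the pair `e₁, e₃` from `B 0` and `B 1`, and `e₂` from `G 1`.
-/
theorem exists_symm_coefficients {q : ℂ} {d B G : ℕ → ℂ} (hq : q ≠ 0)
    (hinj : Function.Injective fun n : ℕ => q ^ n) (hq1 : 1 + q ≠ 0) (hd0 : d 0 ≠ 0)
    (hG0 : G 0 = 0) (hG : ∀ n, G (n + 1) ≠ 0)
    (h₃ : ∀ n, d n - (q + q⁻¹) * d (n + 1) + d (n + 2) = 0)
    (h₂ : ∀ n, d n * (B (n + 2) + B (n + 1)) + d (n + 1) * (B (n + 1) + B n) =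
      (q + q⁻¹) * (d (n + 1) * B (n + 2) + d n * B n))
    (h₁ : ∀ n, d n * (G (n + 2) + 2 * G (n + 1) + B (n + 1) ^ 2 + B n ^ 2 + G n)
        - G n * d (n - 1) - G (n + 2) * d (n + 1) - (1 - (q + q⁻¹) ^ 2 / 4) * d n =
      (q + q⁻¹) * (d (n + 1) * G (n + 2) + B n * B (n + 1) * d n - G (n + 1) * d n
        + G n * d (n - 1))) :
    ∃ E : Fin 5 → ℂ, (∀ n : ℕ, E 0 - E 4 * q ^ n ≠ 0) ∧ (∀ n, B n = symmB q E n) ∧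
      ∀ n, G (n + 1) = symmCSucc q E n := by
  have hne : ∀ n : ℕ, n ≠ 0 → 1 - q ^ n ≠ 0 := fun n hn h =>
    hn (hinj (by simpa using (sub_eq_zero.1 h).symm))
  have hq1' : 1 - q ≠ 0 := by simpa using hne 1 one_ne_zero
  obtain ⟨e₀, e₄, hd⟩ := exists_eq_offDiag hq (fun h => hne 2 two_ne_zero (by rw [h, sub_self])) h₃
  have h04 : e₀ - e₄ ≠ 0 := by simpa [hd 0] using hd0
  -- `w` is the conserved quantity of `linear_recurrence_B`; `e₁, e₃` solve `e₁ - e₃ = 2(e₀ - e₄) B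
  -- 0` and `q e₁ + e₃ = 2 q w / (1 - q)`.
  obtain ⟨w, hw⟩ : ∃ w, w = (e₀ / q - e₄ * q) * B 1 - (e₀ / (1 / q) - e₄ * (1 / q)) * B 0 :=
    ⟨_, rfl⟩
  obtain ⟨e₁, he₁⟩ : ∃ e₁, e₁ = (2 * (e₀ - e₄) * B 0 + 2 * q * w / (1 - q)) / (1 + q) := ⟨_, rfl⟩
  obtain ⟨e₃, he₃⟩ : ∃ e₃, e₃ = e₁ - 2 * (e₀ - e₄) * B 0 := ⟨_, rfl⟩
  -- At `e₀ + e₄` the cubic is affine in `e₂` with slope `-(e₀ - e₄)²`, so `G 1` fixes `e₂`.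
  obtain ⟨r, hr⟩ : ∃ r, r = resolventCubic ![e₀, e₁, 0, e₃, e₄] (e₀ + e₄) := ⟨_, rfl⟩
  obtain ⟨e₂, he₂⟩ : ∃ e₂, e₂ = (r - 4 * q * (e₀ - e₄) ^ 2 * (e₀ / q - e₄) * G 1 / (1 - q)) /
    (e₀ - e₄) ^ 2 := ⟨_, rfl⟩
  obtain ⟨E, hE⟩ : ∃ E : Fin 5 → ℂ, E = ![e₀, e₁, e₂, e₃, e₄] := ⟨_, rfl⟩
  have E0 : E 0 = e₀ := by rw [hE]; rfl
  have E1 : E 1 = e₁ := by rw [hE]; rfl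
  have E2 : E 2 = e₂ := by rw [hE]; rfl
  have E3 : E 3 = e₃ := by rw [hE]; rfl
  have E4 : E 4 = e₄ := by rw [hE]; rfl
  have hd' : ∀ n, d n = offDiag E (q ^ n) := fun n => by rw [hd, offDiag, E0, E4]
  have hd0' : E 0 - E 4 ≠ 0 := by rwa [E0, E4]
  have hB0 : 2 * (E 0 - E 4) * B 0 = E 1 - E 3 := by rw [E0, E4, E1, E3, he₃]; ring
  have hW0 : offDiag E q * B 1 - offDiag E (1 / q) * B 0 =
      (1 - q) / (2 * q) * (q * E 1 + E 3) := by
    have e : q * e₁ + e₃ = 2 * q * w / (1 - q) := by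
      rw [he₃, show q * e₁ + (e₁ - 2 * (e₀ - e₄) * B 0) = (1 + q) * e₁ - 2 * (e₀ - e₄) * B 0 by ring,
        he₁, mul_div_cancel₀ _ hq1]
      ring
    rw [E1, E3, e, offDiag, offDiag, E0, E4, ← hw]
    field_simp
  have hG1 : 4 * q * (E 0 - E 4) ^ 2 * offDiagMid q E q * G 1 =
      (1 - q) * resolventCubic E (E 0 + E 4) := by
    have e : resolventCubic E (E 0 + E 4) = r - e₂ * (e₀ - e₄) ^ 2 := by
      rw [hr]
      simp only [resolventCubic, E0, E1, E2, E3, E4]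
      simp
      ring
    rw [e, he₂, offDiagMid, E0, E4]
    field_simp
    ring
  have hW := linear_recurrence_B hq hd' h₂ hW0
  have hb := offDiag_mul_B hq hB0 hW
  have hV := difference_C_eq_potential hq hd' hd0' hG0 h₁ hB0 hW hG1
  have hn := ne_mul_pow hq hinj hq1 hd0' hG0 hG hW hb hV
  have hC := coeffC_eq hq hq1 hn hb hG1 hV
  refine ⟨E, hn, fun n => ?_, fun n => ?_⟩
  · rcases n with _ | n
    · rw [symmB, if_pos rfl, eq_div_iff (mul_ne_zero two_ne_zero hd0')]
      linear_combination hB0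
    · rw [symmB, if_neg n.succ_ne_zero, eq_div_iff]
      · linear_combination hb (n + 1)
      · refine mul_ne_zero (offDiag_pow_ne_zero hq hn _) ?_
        rw [pow_succ, mul_div_cancel_right₀ _ hq]
        exact offDiag_pow_ne_zero hq hn _
  · have g₁ := offDiagMid_pow_ne_zero hq hn n
    have hs := pow_ne_zero n hq
    -- For `n = 0` the equation `hC` carries the factor `e₀ - e₄ / q`, which may vanish, so `hG1` is
    -- used instead.
    rcases n with _ | n
    · rw [pow_zero, mul_one] at g₁
      rw [symmCSucc, if_pos rfl, eq_div_iff (by simp [hq, g₁, hd0'])]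
      linear_combination hG1
    · have g₀ := offDiagMid_pow_ne_zero hq hn n
      have h := hC (n + 1)
      have h0 := offDiag_pow_ne_zero hq hn (n + 1)
      rw [← pow_succ'] at g₀
      rw [symmCSucc, if_neg n.succ_ne_zero, eq_div_iff (by simp [hq, g₁, g₀, h0])]
      rw [eq_div_iff (by simp [hq])] at h
      linear_combination h

/-! ### From the quartic to Askey-Wilson parameters -/

section Parameters

variable {q : ℝ} {a : Fin 4 → ℂ} {E : Fin 5 → ℂ}

/-- `a` lists the roots of `e₀ x⁴ - e₁ x³ + e₂ x² - e₃ x + e₄`. -/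
structure IsRootTuple (E : Fin 5 → ℂ) (a : Fin 4 → ℂ) : Prop where
  one : E 1 = E 0 * (a 0 + a 1 + a 2 + a 3)
  two : E 2 = E 0 * (a 0 * a 1 + a 0 * a 2 + a 0 * a 3 + a 1 * a 2 + a 1 * a 3 + a 2 * a 3)
  three : E 3 = E 0 * (a 0 * a 1 * a 2 + a 0 * a 1 * a 3 + a 0 * a 2 * a 3 + a 1 * a 2 * a 3)
  four : E 4 = E 0 * awProd a

theorem exists_isRootTuple (h0 : E 0 ≠ 0) : ∃ a, IsRootTuple E a := by
  -- Roots are split off one at a time; each next polynomial is the quotient by synthetic division.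
  obtain ⟨r, hr⟩ := IsAlgClosed.exists_root
    (X ^ 4 - C (E 1 / E 0) * X ^ 3 + C (E 2 / E 0) * X ^ 2 - C (E 3 / E 0) * X + C (E 4 / E 0))
    (by
      intro h
      have h' := natDegree_eq_zero_iff_degree_le_zero.2 h.le
      have : (X ^ 4 - C (E 1 / E 0) * X ^ 3 + C (E 2 / E 0) * X ^ 2 - C (E 3 / E 0) * X
        + C (E 4 / E 0)).natDegree = 4 := by compute_degree!
      omega)
  obtain ⟨s, hs⟩ := IsAlgClosed.exists_root
    (X ^ 3 - C (E 1 / E 0 - r) * X ^ 2 + C (E 2 / E 0 - r * (E 1 / E 0 - r)) * X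
      - C (E 3 / E 0 - r * (E 2 / E 0 - r * (E 1 / E 0 - r))))
    (by
      intro h
      have h' := natDegree_eq_zero_iff_degree_le_zero.2 h.le
      have : (X ^ 3 - C (E 1 / E 0 - r) * X ^ 2 + C (E 2 / E 0 - r * (E 1 / E 0 - r)) * X
        - C (E 3 / E 0 - r * (E 2 / E 0 - r * (E 1 / E 0 - r)))).natDegree = 3 := by
        compute_degree!
      omega)
  obtain ⟨t, ht⟩ := IsAlgClosed.exists_root
    (X ^ 2 - C (E 1 / E 0 - r - s) * X
      + C (E 2 / E 0 - r * (E 1 / E 0 - r) - s * (E 1 / E 0 - r - s)))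
    (by
      intro h
      have h' := natDegree_eq_zero_iff_degree_le_zero.2 h.le
      have : (X ^ 2 - C (E 1 / E 0 - r - s) * X
        + C (E 2 / E 0 - r * (E 1 / E 0 - r) - s * (E 1 / E 0 - r - s))).natDegree = 2 := by
        compute_degree!
      omega)
  simp only [IsRoot.def, eval_add, eval_sub, eval_mul, eval_pow, eval_X, eval_C] at hr hs ht
  have i1 : E 1 = E 0 * (E 1 / E 0) := (mul_div_cancel₀ _ h0).symm
  have i2 : E 2 = E 0 * (E 2 / E 0) := (mul_div_cancel₀ _ h0).symm
  have i3 : E 3 = E 0 * (E 3 / E 0) := (mul_div_cancel₀ _ h0).symm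
  have i4 : E 4 = E 0 * (E 4 / E 0) := (mul_div_cancel₀ _ h0).symm
  generalize E 1 / E 0 = f₁ at *
  generalize E 2 / E 0 = f₂ at *
  generalize E 3 / E 0 = f₃ at *
  generalize E 4 / E 0 = f₄ at *
  obtain rfl : f₂ = (f₁ - r - s) * t - t ^ 2 + r * (f₁ - r) + s * (f₁ - r - s) := by
    linear_combination ht
  obtain ⟨u, rfl⟩ : ∃ u, f₁ = r + s + t + u := ⟨f₁ - r - s - t, by ring⟩
  refine ⟨![r, s, t, u], ?_, ?_, ?_, ?_⟩
  · rw [i1]; simp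
  · rw [i2]; simp; left; ring
  · rw [i3]; simp; left; linear_combination -hs
  · rw [i4]; simp [awProd]; left; linear_combination hr - r * hs

/-- The cubic has the roots `e₀ (a_i a_j + a_k a_l)`, and `e₀/s + e₄ s` minus such a root is
`(e₀/s)(1 - a_i a_j s)(1 - a_k a_l s)`. -/
theorem IsRootTuple.resolventCubic_eq (h : IsRootTuple E a) {s : ℂ} (hs : s ≠ 0) :
    resolventCubic E (E 0 / s + E 4 * s) = E 0 ^ 3 *
      ((1 - a 0 * a 1 * s) * (1 - a 0 * a 2 * s) * (1 - a 0 * a 3 * s)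
      * (1 - a 1 * a 2 * s) * (1 - a 1 * a 3 * s) * (1 - a 2 * a 3 * s)) / s ^ 3 := by
  simp only [resolventCubic, h.one, h.two, h.three, h.four, awProd]
  field_simp
  ring

theorem IsRootTuple.awAdmissible (h : IsRootTuple E a) (hq : (q : ℂ) ≠ 0) (h4 : E 4 ≠ 0)
    (hE4 : E 4 ≠ q * E 0) (hE : ∀ n : ℕ, E 0 - E 4 * (q : ℂ) ^ n ≠ 0)
    (hR : ∀ n : ℕ, resolventCubic E (E 0 / (q : ℂ) ^ n + E 4 * (q : ℂ) ^ n) ≠ 0) :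
    AWAdmissible q a := by
  refine ⟨fun h0 => h4 ?_, fun hσ => hE4 ?_, fun n => ?_⟩
  · simp [h.four, awProd, h0]
  · rw [h.four, hσ, mul_comm]
  · have e := hE n
    have e' := hR n
    rw [h.resolventCubic_eq (pow_ne_zero n hq)] at e'
    rw [h.four] at e
    have e₁ : 1 - awProd a * (q : ℂ) ^ n ≠ 0 := fun h1 => e (by linear_combination E 0 * h1)
    have e₂ := (mul_ne_zero_iff.1 (div_ne_zero_iff.1 e').1).2
    have := mul_ne_zero e₁ e₂
    simpa only [mul_assoc] using this

theorem IsRootTuple.awB_eq (h : IsRootTuple E a) (hq : (q : ℂ) ≠ 0) (h0 : E 0 ≠ 0)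
    (ha : a 0 ≠ 0) (hσ : awProd a ≠ q) (hE : ∀ n : ℕ, 1 - awProd a * (q : ℂ) ^ n ≠ 0) (n : ℕ) :
    awB q a n = symmB q E n := by
  rcases n with _ | n
  · have e := hE 0
    have e' : 1 - awProd a * (q : ℂ)⁻¹ ≠ 0 := by
      intro h1
      apply hσ
      field_simp at h1
      linear_combination -h1
    have i₁ : (q : ℂ) ^ (((0 : ℕ) : ℤ) - 1) = (q : ℂ)⁻¹ := by simp
    have i₂ : (q : ℂ) ^ (2 * ((0 : ℕ) : ℤ) - 1) = (q : ℂ)⁻¹ := by simp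
    have e₁ : E 0 - E 4 = E 0 * (1 - awProd a) := by rw [h.four]; ring
    rw [symmB, if_pos rfl, awB, i₁, i₂, e₁, h.one, h.three]
    simp only [mul_zero, pow_zero, mul_one, sub_self, zero_mul, zero_div, sub_zero] at e ⊢
    generalize 1 - awProd a * (q : ℂ)⁻¹ = D at *
    obtain ⟨M, hM⟩ : ∃ M, M = 1 - awProd a := ⟨_, rfl⟩
    rw [← hM] at e ⊢
    field_simp
    rw [hM, awProd]
    ring
  · have hs := pow_ne_zero n hq
    have i₁ : (q : ℂ) ^ (((n + 1 : ℕ) : ℤ) - 1) = (q : ℂ) ^ n := by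
      rw [← zpow_natCast]; congr 1; push_cast; ring
    have i₂ : (q : ℂ) ^ (2 * ((n + 1 : ℕ) : ℤ) - 1) = (q : ℂ) ^ (2 * n + 1) := by
      rw [← zpow_natCast]; congr 1; push_cast; ring
    have i₃ : (q : ℂ) ^ (2 * ((n + 1 : ℕ) : ℤ) - 2) = (q : ℂ) ^ (2 * n) := by
      rw [← zpow_natCast]; congr 1; push_cast; ring
    have d₁ := hE (2 * n + 1)
    have d₂ := hE (2 * (n + 1))
    have d₃ := hE (2 * n)
    have o₁ : offDiag E ((q : ℂ) ^ (n + 1)) =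
        E 0 * (1 - awProd a * (q : ℂ) ^ (2 * (n + 1))) / (q * (q : ℂ) ^ n) := by
      rw [offDiag, h.four, mul_comm 2, pow_mul, pow_succ' (q : ℂ) n]; field_simp
    have o₂ : offDiag E ((q : ℂ) ^ (n + 1) / q) =
        E 0 * (1 - awProd a * (q : ℂ) ^ (2 * n)) / (q : ℂ) ^ n := by
      rw [offDiag, h.four, mul_comm 2, pow_mul, pow_succ' (q : ℂ) n]; field_simp
    have o₃ : symmBNum q E ((q : ℂ) ^ (n + 1)) = E 0 ^ 2 *
        ((1 / (q * (q : ℂ) ^ n) + awProd a * (q : ℂ) ^ n) * (q * (a 0 + a 1 + a 2 + a 3) +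
          (a 0 * a 1 * a 2 + a 0 * a 1 * a 3 + a 0 * a 2 * a 3 + a 1 * a 2 * a 3))
          - (1 + q) / q * (awProd a * (a 0 + a 1 + a 2 + a 3) + q *
          (a 0 * a 1 * a 2 + a 0 * a 1 * a 3 + a 0 * a 2 * a 3 + a 1 * a 2 * a 3))) / 2 := by
      rw [symmBNum, h.one, h.three, h.four, pow_succ']; field_simp
    rw [symmB, if_neg n.succ_ne_zero, awB, i₁, i₂, i₃, o₁, o₂, o₃]
    obtain ⟨M₁, hM₁⟩ : ∃ M, M = 1 - awProd a * (q : ℂ) ^ (2 * n + 1) := ⟨_, rfl⟩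
    obtain ⟨M₂, hM₂⟩ : ∃ M, M = 1 - awProd a * (q : ℂ) ^ (2 * (n + 1)) := ⟨_, rfl⟩
    obtain ⟨M₃, hM₃⟩ : ∃ M, M = 1 - awProd a * (q : ℂ) ^ (2 * n) := ⟨_, rfl⟩
    rw [← hM₁] at d₁ ⊢
    rw [← hM₂] at d₂ ⊢
    rw [← hM₃] at d₃ ⊢
    have p₁ : (q : ℂ) ^ (2 * n + 1) = q * ((q : ℂ) ^ n) ^ 2 := by ring
    have p₂ : (q : ℂ) ^ (2 * (n + 1)) = q ^ 2 * ((q : ℂ) ^ n) ^ 2 := by ring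
    have p₃ : (q : ℂ) ^ (2 * n) = ((q : ℂ) ^ n) ^ 2 := by ring
    rw [p₁] at hM₁
    rw [p₂] at hM₂
    rw [p₃] at hM₃
    rw [pow_succ']
    generalize (q : ℂ) ^ n = s at *
    field_simp
    rw [hM₁, hM₂, hM₃, awProd]
    ring

theorem IsRootTuple.awCSucc_eq (h : IsRootTuple E a) (hq : (q : ℂ) ≠ 0) (h0 : E 0 ≠ 0)
    (hσ : awProd a ≠ q) (hE : ∀ n : ℕ, 1 - awProd a * (q : ℂ) ^ n ≠ 0) (n : ℕ) :
    awCSucc q a n = symmCSucc q E n := by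
  rcases n with _ | n
  · have e := hE 0
    have e1 := hE 1
    have e' : 1 - awProd a * (q : ℂ)⁻¹ ≠ 0 := by
      intro h1
      apply hσ
      field_simp at h1
      linear_combination -h1
    have i₁ : (q : ℂ) ^ (((0 : ℕ) : ℤ) - 1) = (q : ℂ)⁻¹ := by simp
    have i₂ : (q : ℂ) ^ (2 * ((0 : ℕ) : ℤ) - 1) = (q : ℂ)⁻¹ := by simp
    have e₁ : E 0 - E 4 = E 0 * (1 - awProd a) := by rw [h.four]; ring
    have e₂ : offDiagMid q E q = E 0 * (1 - awProd a * q) / q := by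
      rw [offDiagMid, h.four]; field_simp
    have e₃ := h.resolventCubic_eq one_ne_zero
    rw [div_one, mul_one] at e₃
    rw [symmCSucc, if_pos rfl, awCSucc, i₁, i₂, e₁, e₂, e₃]
    simp only [mul_zero, pow_zero, mul_one, zero_add, pow_one] at e e1 ⊢
    field_simp
  · have hs := pow_ne_zero n hq
    have i₁ : (q : ℂ) ^ (((n + 1 : ℕ) : ℤ) - 1) = (q : ℂ) ^ n := by
      rw [← zpow_natCast]; congr 1; push_cast; ring
    have i₂ : (q : ℂ) ^ (2 * ((n + 1 : ℕ) : ℤ) - 1) = (q : ℂ) ^ (2 * n + 1) := by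
      rw [← zpow_natCast]; congr 1; push_cast; ring
    have d₁ := hE (2 * n + 1)
    have d₂ := hE (2 * (n + 1))
    have d₃ := hE (2 * (n + 1) + 1)
    have o₁ : offDiag E ((q : ℂ) ^ (n + 1)) =
        E 0 * (1 - awProd a * (q : ℂ) ^ (2 * (n + 1))) / (q * (q : ℂ) ^ n) := by
      rw [offDiag, h.four, mul_comm 2, pow_mul, pow_succ' (q : ℂ) n]; field_simp
    have o₂ : offDiagMid q E ((q : ℂ) ^ (n + 1)) =
        E 0 * (1 - awProd a * (q : ℂ) ^ (2 * n + 1)) / (q * (q : ℂ) ^ n) := by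
      rw [offDiagMid, h.four, pow_succ _ (2 * n), mul_comm 2, pow_mul, pow_succ' (q : ℂ) n]
      field_simp
    have o₃ : offDiagMid q E (q * (q : ℂ) ^ (n + 1)) =
        E 0 * (1 - awProd a * (q : ℂ) ^ (2 * (n + 1) + 1)) / (q * (q * (q : ℂ) ^ n)) := by
      rw [offDiagMid, h.four, pow_succ _ (2 * (n + 1)), mul_comm 2, pow_mul, pow_succ' (q : ℂ) n]
      field_simp
    have o₄ : E 0 - E 4 * (q : ℂ) ^ (n + 1) / q = E 0 * (1 - awProd a * (q : ℂ) ^ n) := by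
      rw [h.four, pow_succ' (q : ℂ) n]; field_simp
    rw [symmCSucc, if_neg n.succ_ne_zero, awCSucc, i₁, i₂, o₁, o₂, o₃, o₄,
      h.resolventCubic_eq (pow_ne_zero _ hq), pow_succ' (q : ℂ) (n + 1)]
    generalize 1 - awProd a * (q : ℂ) ^ (2 * n + 1) = M₁ at *
    generalize 1 - awProd a * (q : ℂ) ^ (2 * (n + 1)) = M₂ at *
    generalize 1 - awProd a * (q : ℂ) ^ (2 * (n + 1) + 1) = M₃ at *
    generalize (1 - a 0 * a 1 * (q : ℂ) ^ (n + 1)) * (1 - a 0 * a 2 * (q : ℂ) ^ (n + 1))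
      * (1 - a 0 * a 3 * (q : ℂ) ^ (n + 1)) * (1 - a 1 * a 2 * (q : ℂ) ^ (n + 1))
      * (1 - a 1 * a 3 * (q : ℂ) ^ (n + 1)) * (1 - a 2 * a 3 * (q : ℂ) ^ (n + 1)) = R at *
    generalize 1 - awProd a * (q : ℂ) ^ n = N at *
    rw [pow_succ' (q : ℂ) n]
    generalize (q : ℂ) ^ n = s at *
    field_simp

end Parameters

/-! ### Approximation by admissible parameters -/

/-- A line through `E` whose generic points belong to admissible parameters. -/
def perturb (E : Fin 5 → ℂ) (t : ℂ) (i : Fin 5) : ℂ := E i + t * ![1, 0, 0, 0, Complex.I] i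

theorem countable_setOf_eq_zero {f : ℂ → ℂ} (p : ℂ[X]) (hp : ∀ t, p.eval t = f t) {t₀ : ℂ}
    (h : f t₀ ≠ 0) : {t | f t = 0}.Countable := by
  have h0 : p ≠ 0 := by
    rintro rfl
    exact h (by rw [← hp, eval_zero])
  refine ((finite_setOfPred_isRoot h0).subset fun t ht => ?_).countable
  simpa [IsRoot.def, hp] using ht

/-- Each condition excludes the zeros of a nonzero polynomial in `t`. Countably many finite sets are
removed, so the complement is dense and accumulates at `0`. -/
theorem exists_perturb_seq {q : ℝ} {E : Fin 5 → ℂ}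
    (hE : ∀ n : ℕ, E 0 - E 4 * (q : ℂ) ^ n ≠ 0)
    (hR : ∀ n : ℕ, resolventCubic E (E 0 / (q : ℂ) ^ n + E 4 * (q : ℂ) ^ n) ≠ 0) :
    ∃ t : ℕ → ℂ, Tendsto t atTop (𝓝 0) ∧ ∀ j, perturb E (t j) 0 ≠ 0 ∧ perturb E (t j) 4 ≠ 0 ∧
      perturb E (t j) 4 ≠ q * perturb E (t j) 0 ∧
      (∀ n : ℕ, perturb E (t j) 0 - perturb E (t j) 4 * (q : ℂ) ^ n ≠ 0) ∧
      ∀ n : ℕ, resolventCubic (perturb E (t j))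
        (perturb E (t j) 0 / (q : ℂ) ^ n + perturb E (t j) 4 * (q : ℂ) ^ n) ≠ 0 := by
  have p0 : ∀ t, perturb E t 0 = E 0 + t := fun t => by simp [perturb]
  have p1 : ∀ t, perturb E t 1 = E 1 := fun t => by simp [perturb]
  have p2 : ∀ t, perturb E t 2 = E 2 := fun t => by simp [perturb]
  have p3 : ∀ t, perturb E t 3 = E 3 := fun t => by simp [perturb]
  have p4 : ∀ t, perturb E t 4 = E 4 + Complex.I * t := fun t => by
    simp [perturb, mul_comm]
  have c0 : {t | perturb E t 0 = 0}.Countable :=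
    countable_setOf_eq_zero (C (E 0) + X) (fun t => by simp [p0]) (t₀ := 1 - E 0)
      (by rw [p0]; simp)
  have c4 : {t | perturb E t 4 = 0}.Countable := by
    refine countable_setOf_eq_zero (C (E 4) + C Complex.I * X) (fun t => by simp [p4])
      (t₀ := (1 - E 4) / Complex.I) ?_
    rw [p4, mul_div_cancel₀ _ Complex.I_ne_zero]; simp
  -- The non-real direction keeps `e₄ - q e₀` nonconstant along the line.
  have hI : Complex.I - q ≠ 0 := fun h => by simpa using congrArg Complex.im h
  have c04 : {t | perturb E t 4 - q * perturb E t 0 = 0}.Countable := by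
    refine countable_setOf_eq_zero (C (E 4) + C Complex.I * X - C (q : ℂ) * (C (E 0) + X))
      (fun t => by simp [p0, p4]) (t₀ := (1 - (E 4 - q * E 0)) / (Complex.I - q)) ?_
    have e := div_mul_cancel₀ (1 - (E 4 - q * E 0)) hI
    rw [p0, p4]
    intro h
    apply one_ne_zero (α := ℂ)
    linear_combination h - e
  have cE : ∀ n : ℕ, {t | perturb E t 0 - perturb E t 4 * (q : ℂ) ^ n = 0}.Countable := fun n =>
    countable_setOf_eq_zero (C (E 0) + X - (C (E 4) + C Complex.I * X) * C ((q : ℂ) ^ n))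
      (fun t => by simp [p0, p4]) (t₀ := 0) (by simpa [p0, p4] using hE n)
  have hz : perturb E 0 = E := by ext i; simp [perturb]
  have cR : ∀ n : ℕ, {t | resolventCubic (perturb E t)
      (perturb E t 0 / (q : ℂ) ^ n + perturb E t 4 * (q : ℂ) ^ n) = 0}.Countable := fun n => by
    obtain ⟨e₀, he₀⟩ : ∃ e : ℂ[X], e = C (E 0) + X := ⟨_, rfl⟩
    obtain ⟨e₄, he₄⟩ : ∃ e : ℂ[X], e = C (E 4) + C Complex.I * X := ⟨_, rfl⟩
    obtain ⟨y, hy⟩ : ∃ y : ℂ[X], y = e₀ * C ((q : ℂ) ^ n)⁻¹ + e₄ * C ((q : ℂ) ^ n) := ⟨_, rfl⟩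
    refine countable_setOf_eq_zero
      (y ^ 3 - C (E 2) * y ^ 2 + (C (E 1 * E 3) - 4 * e₀ * e₄) * y
        - (e₀ * C (E 3 ^ 2) + C (E 1 ^ 2) * e₄ - 4 * e₀ * C (E 2) * e₄)) (fun t => ?_) (t₀ := 0)
      (by rw [hz]; exact hR n)
    have h0 : e₀.eval t = perturb E t 0 := by simp [he₀, p0]
    have h4 : e₄.eval t = perturb E t 4 := by simp [he₄, p4]
    have hy' : y.eval t = perturb E t 0 / (q : ℂ) ^ n + perturb E t 4 * (q : ℂ) ^ n := by
      rw [hy, eval_add, eval_mul, eval_mul, eval_C, eval_C, h0, h4, div_eq_mul_inv]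
    have h4' : (4 : ℂ[X]).eval t = 4 := eval_ofNat 4 t
    simp only [eval_sub, eval_add, eval_mul, eval_pow, eval_C, h0, h4, hy', h4', resolventCubic,
      p1, p2, p3]
  have hc := ((c0.union c4).union c04).union
    ((Set.countable_iUnion cE).union (Set.countable_iUnion cR))
  have hd := hc.dense_compl ℂ
  obtain ⟨t, ht, ht0⟩ := mem_closure_iff_seq_limit.1 (hd 0)
  refine ⟨t, ht0, fun j => ?_⟩
  have h := ht j
  simp only [Set.mem_compl_iff, Set.mem_union, Set.mem_iUnion, Set.mem_ofPred_eq, not_or,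
    not_exists] at h
  exact ⟨h.1.1.1, h.1.1.2, fun e => h.1.2 (sub_eq_zero.2 e), h.2.1, h.2.2⟩

theorem continuousAt_symmB {q : ℂ} {E : Fin 5 → ℂ} (hq : q ≠ 0)
    (hE : ∀ n : ℕ, E 0 - E 4 * q ^ n ≠ 0) (n : ℕ) :
    ContinuousAt (fun F : Fin 5 → ℂ => symmB q F n) E := by
  rcases n with _ | n
  · have h := hE 0
    rw [pow_zero, mul_one] at h
    simp only [symmB, if_pos]
    exact ContinuousAt.div (by fun_prop) (by fun_prop) (mul_ne_zero two_ne_zero h)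
  · simp only [symmB, if_neg n.succ_ne_zero, symmBNum, offDiag]
    have h₁ := offDiag_pow_ne_zero hq hE (n + 1)
    have h₂ := offDiag_pow_ne_zero hq hE n
    refine ContinuousAt.div (by fun_prop) (by fun_prop) (mul_ne_zero h₁ ?_)
    rw [pow_succ, mul_div_cancel_right₀ _ hq]
    exact h₂

theorem continuousAt_symmCSucc {q : ℂ} {E : Fin 5 → ℂ} (hq : q ≠ 0)
    (hE : ∀ n : ℕ, E 0 - E 4 * q ^ n ≠ 0) (n : ℕ) :
    ContinuousAt (fun F : Fin 5 → ℂ => symmCSucc q F n) E := by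
  have g := offDiagMid_pow_ne_zero hq hE n
  rcases n with _ | n
  · have h := hE 0
    rw [pow_zero, mul_one] at h g
    simp only [symmCSucc, if_pos, offDiagMid, resolventCubic]
    refine ContinuousAt.div (by fun_prop) (by fun_prop) ?_
    exact mul_ne_zero (mul_ne_zero (by simp [hq]) g) (pow_ne_zero 2 h)
  · simp only [symmCSucc, if_neg n.succ_ne_zero, offDiagMid, resolventCubic, offDiag]
    have h₁ := offDiag_pow_ne_zero hq hE (n + 1)
    have h₂ := offDiagMid_pow_ne_zero hq hE n
    rw [← pow_succ'] at h₂
    refine ContinuousAt.div (by fun_prop) (by fun_prop) ?_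
    exact mul_ne_zero (mul_ne_zero (mul_ne_zero (by simp [hq]) h₂) g) (pow_ne_zero 2 h₁)

theorem exists_admissible_seq {q : ℝ} {E : Fin 5 → ℂ} (hq : (q : ℂ) ≠ 0)
    (hE : ∀ n : ℕ, E 0 - E 4 * (q : ℂ) ^ n ≠ 0) (hC : ∀ n, symmCSucc q E n ≠ 0) :
    ∃ a : ℕ → Fin 4 → ℂ, (∀ j, AWAdmissible q (a j)) ∧
      (∀ n, Tendsto (fun j => awB q (a j) n) atTop (𝓝 (symmB q E n))) ∧
      ∀ n, Tendsto (fun j => awCSucc q (a j) n) atTop (𝓝 (symmCSucc q E n)) := by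
  have hR : ∀ n : ℕ, resolventCubic E (E 0 / (q : ℂ) ^ n + E 4 * (q : ℂ) ^ n) ≠ 0 := by
    intro n h
    apply hC n
    rcases n with _ | n
    · rw [pow_zero, div_one, mul_one] at h
      rw [symmCSucc, if_pos rfl, h, mul_zero, zero_div]
    · rw [symmCSucc, if_neg n.succ_ne_zero, h, mul_zero, zero_div]
  obtain ⟨t, ht, h⟩ := exists_perturb_seq hE hR
  choose a ha using fun j => exists_isRootTuple (h j).1
  have hadm : ∀ j, AWAdmissible q (a j) := fun j =>
    (ha j).awAdmissible hq (h j).2.1 (h j).2.2.1 (h j).2.2.2.1 (h j).2.2.2.2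
  have hσ : ∀ j (n : ℕ), 1 - awProd (a j) * (q : ℂ) ^ n ≠ 0 := fun j n e => by
    apply (h j).2.2.2.1 n
    rw [(ha j).four]
    linear_combination perturb E (t j) 0 * e
  have hlim : Tendsto (fun j => perturb E (t j)) atTop (𝓝 E) := by
    have hc : Continuous (perturb E) := by unfold perturb; fun_prop
    have := (hc.tendsto 0).comp ht
    rwa [show perturb E 0 = E by ext i; simp [perturb]] at this
  refine ⟨a, hadm, fun n => ?_, fun n => ?_⟩
  · simp only [fun j => (ha j).awB_eq hq (h j).1 (hadm j).1 (hadm j).2.1 (hσ j) n]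
    exact (continuousAt_symmB hq hE n).tendsto.comp hlim
  · simp only [fun j => (ha j).awCSucc_eq hq (h j).1 (hadm j).2.1 (hσ j) n]
    exact (continuousAt_symmCSucc hq hE n).tendsto.comp hlim

theorem tendsto_coeff_awMonic {q : ℝ} {a : ℕ → Fin 4 → ℂ} {Q : ℕ → ℂ[X]} {B G : ℕ → ℂ}
    (hQ0 : Q 0 = 1) (hG0 : G 0 = 0)
    (hX : ∀ n, X * Q n = Q (n + 1) + B n • Q n + G n • Q (n - 1))
    (hB : ∀ n, Tendsto (fun j => awB q (a j) n) atTop (𝓝 (B n)))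
    (hG : ∀ n, Tendsto (fun j => awCSucc q (a j) n) atTop (𝓝 (G (n + 1)))) (n i : ℕ) :
    Tendsto (fun j => (awMonic q (a j) n).coeff i) atTop (𝓝 ((Q n).coeff i)) := by
  induction n using Nat.twoStepInduction generalizing i with
  | zero => simp only [awMonic, hQ0]; exact tendsto_const_nhds
  | one =>
    have h1 : Q 1 = X - C (B 0) := by
      have := hX 0
      rw [hQ0, hG0, zero_smul, add_zero, mul_one, zero_add] at this
      rw [this, smul_eq_C_mul]; ring
    simp only [awMonic, h1, coeff_sub, coeff_C]
    split_ifs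
    · exact tendsto_const_nhds.sub (hB 0)
    · exact tendsto_const_nhds
  | more n ih₀ ih₁ =>
    have h2 : Q (n + 2) = X * Q (n + 1) - C (B (n + 1)) * Q (n + 1) - C (G (n + 1)) * Q n := by
      have := hX (n + 1)
      rw [show n + 1 - 1 = n from rfl] at this
      rw [this, smul_eq_C_mul, smul_eq_C_mul]; ring
    have hXc : Tendsto (fun j => (X * awMonic q (a j) (n + 1)).coeff i) atTop
        (𝓝 ((X * Q (n + 1)).coeff i)) := by
      rcases i with _ | i
      · simp only [coeff_X_mul_zero]; exact tendsto_const_nhds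
      · simp only [coeff_X_mul]; exact ih₁ i
    simp only [awMonic, h2, sub_mul, coeff_sub, coeff_C_mul]
    exact (hXc.sub ((hB (n + 1)).mul (ih₁ i))).sub ((hG n).mul (ih₀ i))

/-! ### The skew form of the structure relation -/

/-- `S_q D_q` as a linear map. -/
def awAverDiffLinear (q : ℝ) (hq0 : 0 < q) (hq1 : q < 1) : ℂ[X] →ₗ[ℂ] ℂ[X] where
  toFun := awAverDiff q
  map_add' := awAverDiff_add hq0 hq1
  map_smul' := awAverDiff_smul hq0 hq1

/-- The antisymmetric part of the form `⟨u, f * π * S_q D_q g⟩`. -/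
def structureForm (q : ℝ) (hq0 : 0 < q) (hq1 : q < 1) (u : ℂ[X] →ₗ[ℂ] ℂ) (p : ℂ[X]) :
    ℂ[X] →ₗ[ℂ] ℂ[X] →ₗ[ℂ] ℂ :=
  ((LinearMap.mul ℂ ℂ[X]).compr₂ u).compl₂
      (LinearMap.mulLeft ℂ p ∘ₗ awAverDiffLinear q hq0 hq1) -
    (((LinearMap.mul ℂ ℂ[X]).compr₂ u).compl₂
      (LinearMap.mulLeft ℂ p ∘ₗ awAverDiffLinear q hq0 hq1)).flip

theorem structureForm_apply {q : ℝ} {hq0 : 0 < q} {hq1 : q < 1} (u : ℂ[X] →ₗ[ℂ] ℂ)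
    (p f g : ℂ[X]) : structureForm q hq0 hq1 u p f g =
      u (f * (p * awAverDiff q g)) - u (g * (p * awAverDiff q f)) := rfl

theorem structureForm_X_sq {q : ℝ} {hq0 : 0 < q} {hq1 : q < 1} (u : ℂ[X] →ₗ[ℂ] ℂ)
    (p f g : ℂ[X]) :
    structureForm q hq0 hq1 u p (X ^ 2 * f) g
      - ((q : ℂ) + (q : ℂ)⁻¹) * structureForm q hq0 hq1 u p (X * f) (X * g)
      + structureForm q hq0 hq1 u p f (X ^ 2 * g)
      - (1 - ((q : ℂ) + (q : ℂ)⁻¹) ^ 2 / 4) * structureForm q hq0 hq1 u p f g = 0 := by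
  have hf := awAverDiff_X_sq hq0 hq1 f
  have hg := awAverDiff_X_sq hq0 hq1 g
  have hu : ∀ (c : ℂ) (r : ℂ[X]), c * u r = u (C c * r) := fun c r => by
    rw [← smul_eq_C_mul, map_smul, smul_eq_mul]
  simp only [structureForm_apply, mul_sub, hu]
  simp only [← map_sub, ← map_add]
  convert map_zero u using 2
  -- The right sides of `hf` and `hg` contribute multiples of the symmetric product `f * p * X * g`,
  -- which cancel.
  linear_combination f * p * hg - g * p * hf

theorem structureForm_skew {q : ℝ} {hq0 : 0 < q} {hq1 : q < 1} (u : ℂ[X] →ₗ[ℂ] ℂ)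
    (p f g : ℂ[X]) : structureForm q hq0 hq1 u p f g = -structureForm q hq0 hq1 u p g f := by
  rw [structureForm_apply, structureForm_apply, neg_sub]

/-- Dividing the entries by `κ (n + 1)` absorbs the factors `G` through `hκG`, so the first
recurrence gets constant coefficients. -/
theorem exists_symm_coefficients_of_skew_form {q : ℂ} {Q : ℕ → ℂ[X]} {B G κ : ℕ → ℂ}
    {A : ℂ[X] →ₗ[ℂ] ℂ[X] →ₗ[ℂ] ℂ} (hq : q ≠ 0)
    (hinj : Function.Injective fun n : ℕ => q ^ n) (hq1 : 1 + q ≠ 0)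
    (hG0 : G 0 = 0) (hκ : ∀ n, κ n ≠ 0) (hκG : ∀ n, κ (n + 1) = G (n + 1) * κ n)
    (hX : ∀ n, X * Q n = Q (n + 1) + B n • Q n + G n • Q (n - 1))
    (hA : ∀ f g, A f g = -A g f) (hA0 : ∀ m n, n + 2 ≤ m → A (Q m) (Q n) = 0)
    (hA1 : A (Q 1) (Q 0) ≠ 0)
    (hA2 : ∀ f g, A (X ^ 2 * f) g - (q + q⁻¹) * A (X * f) (X * g) + A f (X ^ 2 * g)
      - (1 - (q + q⁻¹) ^ 2 / 4) * A f g = 0) :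
    ∃ E : Fin 5 → ℂ, (∀ n : ℕ, E 0 - E 4 * q ^ n ≠ 0) ∧ (∀ n, B n = symmB q E n) ∧
      ∀ n, G (n + 1) = symmCSucc q E n := by
  have hG : ∀ n, G (n + 1) ≠ 0 := fun n h => hκ (n + 1) (by rw [hκG, h, zero_mul])
  have hr := tridiagonal_recurrences hG0 hX hA hA0 hA2
    (D := fun n => A (Q (n + 1)) (Q n)) (fun _ => rfl)
  obtain ⟨d, hd⟩ : ∃ d : ℕ → ℂ, ∀ n, A (Q (n + 1)) (Q n) = κ (n + 1) * d n :=
    ⟨fun n => A (Q (n + 1)) (Q n) / κ (n + 1), fun n => (mul_div_cancel₀ _ (hκ _)).symm⟩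
  simp only [hd] at hr
  refine exists_symm_coefficients (d := d) hq hinj hq1 ?_ hG0 hG (fun n => ?_) (fun n => ?_)
    fun n => ?_
  · intro h
    exact hA1 ((hd 0).trans (by rw [h, mul_zero]))
  · apply mul_left_cancel₀ (hκ (n + 3))
    have k₁ := hκG (n + 1)
    have k₂ := hκG (n + 2)
    have e := (hr n).1
    simp only [show n + 1 + 1 = n + 2 from rfl, show n + 2 + 1 = n + 3 from rfl] at *
    rw [k₂, k₁] at e ⊢
    linear_combination e
  · apply mul_left_cancel₀ (hκ (n + 2))
    have k₁ := hκG (n + 1)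
    have e := (hr n).2.1
    simp only [show n + 1 + 1 = n + 2 from rfl] at *
    rw [k₁] at e ⊢
    linear_combination e
  · apply mul_left_cancel₀ (hκ (n + 1))
    have k₁ := hκG (n + 1)
    have e := (hr n).2.2
    have e' : G (n + 1) * G n * (κ (n - 1 + 1) * d (n - 1)) = κ (n + 1) * (G n * d (n - 1)) := by
      rcases n with _ | n
      · simp [hG0]
      · rw [hκG (n + 1), show n + 1 - 1 + 1 = n + 1 from rfl]; ring
    simp only [show n + 1 + 1 = n + 2 from rfl] at *
    rw [e', k₁] at e
    linear_combination e

end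

/-! ### The main theorem -/

theorem corollary3p3 (q : ℝ) (hq0 : 0 < q) (hq1 : q < 1) (P : ℕ → Polynomial ℂ) (hP : IsOPS P)
    (a b c : ℂ) (an bn cn : ℕ → ℂ) (hcn : ∀ n, cn n ≠ 0)
    (hrel : ∀ n, (C a * X ^ 2 + C b * X + C c) * awAver q (awDiff q (P n)) =
      C (an n) * P (n + 1) + C (bn n) * P n
        + C (cn n) * (if n = 0 then 0 else P (n - 1))) :
    IsAskeyWilsonOrLimit q P := by
  obtain ⟨k, Q, u, κ, hk, hPQ, h1, h0, hκ, hu⟩ := hP.exists_monic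
  obtain ⟨B, G, hG0, hκG, hX⟩ := three_term_recurrence h1 h0 hκ hu
  have hq : (q : ℂ) ≠ 0 := by exact_mod_cast hq0.ne'
  have hq1' : 1 + (q : ℂ) ≠ 0 := by exact_mod_cast (by positivity : (1 : ℝ) + q ≠ 0)
  have hinj : Function.Injective fun n : ℕ => (q : ℂ) ^ n := fun m n h =>
    pow_right_injective₀ hq0 hq1.ne (by
      have h' : (q : ℂ) ^ m = (q : ℂ) ^ n := h
      exact_mod_cast h')
  have hPu : ∀ m n, m ≠ n → u (P m * P n) = 0 := fun m n hmn => by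
    rw [hPQ, hPQ, smul_mul_assoc, mul_smul_comm, map_smul, map_smul, hu, if_neg hmn, smul_zero,
      smul_zero]
  have hQ0 : Q 0 = 1 := by
    ext i
    rcases i with _ | i
    · simp [h1]
    · simp [h0 0 (i + 1) i.succ_pos, coeff_one]
  have hC : ∀ (m : ℕ) (r : ℂ) (f : ℂ[X]), u (P m * (C r * f)) = r * u (P m * f) :=
    fun m r f => by rw [← smul_eq_C_mul, mul_smul_comm, map_smul, smul_eq_mul]
  obtain ⟨A, hAdef⟩ : ∃ A, A = structureForm q hq0 hq1 u (C a * X ^ 2 + C b * X + C c) := ⟨_, rfl⟩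
  have hAP : ∀ m n, A (P m) (P n) =
      an n * u (P m * P (n + 1)) + bn n * u (P m * P n)
        + cn n * u (P m * (if n = 0 then 0 else P (n - 1)))
      - (an m * u (P n * P (m + 1)) + bn m * u (P n * P m)
        + cn m * u (P n * (if m = 0 then 0 else P (m - 1)))) := fun m n => by
    rw [hAdef, structureForm_apply, awAverDiff, awAverDiff, hrel, hrel]
    simp only [mul_add, map_add, hC]
  have hAQ : ∀ m n, A (P m) (P n) = k m * k n * A (Q m) (Q n) := fun m n => by
    rw [hPQ, hPQ, map_smul, map_smul, LinearMap.smul_apply, smul_eq_mul, smul_eq_mul]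
    ring
  have hA0 : ∀ m n, n + 2 ≤ m → A (Q m) (Q n) = 0 := fun m n hmn => by
    have e := hAP m n
    rw [hPu m (n + 1) (by omega), hPu m n (by omega), hPu n (m + 1) (by omega),
      hPu n m (by omega), if_neg (show m ≠ 0 by omega), hPu n (m - 1) (by omega), hAQ] at e
    have e' : u (P m * (if n = 0 then 0 else P (n - 1))) = 0 := by
      split_ifs
      · simp
      · exact hPu _ _ (by omega)
    rw [e'] at e
    simpa [hk] using e
  -- `S_q D_q` annihilates the constant `P 0`, so only the term with `cn 1` survives.
  have hA1 : A (Q 1) (Q 0) ≠ 0 := by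
    have e : A (P 1) (P 0) = -(cn 1 * u (P 0 * P 0)) := by
      have hz : awAverDiff q (P 0) = 0 := by
        rw [hPQ, hQ0, awAverDiff_smul hq0 hq1, ← C_1, awAverDiff_C hq0 hq1, smul_zero]
      rw [hAdef, structureForm_apply, hz, mul_zero, mul_zero, map_zero, zero_sub, awAverDiff, hrel]
      simp only [mul_add, map_add, hC]
      rw [hPu 0 (1 + 1) (by omega), hPu 0 1 (by omega)]
      simp
    have e' : u (P 0 * P 0) = k 0 * k 0 * κ 0 := by
      rw [hPQ, smul_mul_assoc, mul_smul_comm, map_smul, map_smul, hu, if_pos rfl, smul_eq_mul,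
        smul_eq_mul, mul_assoc]
    intro h
    rw [hAQ, h, mul_zero, e'] at e
    have hne := mul_ne_zero (hcn 1) (mul_ne_zero (mul_ne_zero (hk 0) (hk 0)) (hκ 0))
    exact hne (neg_eq_zero.1 e.symm)
  obtain ⟨E, hE, hB, hG⟩ := exists_symm_coefficients_of_skew_form hq hinj hq1' hG0 hκ hκG hX
    (A := A) (fun f g => by rw [hAdef]; exact structureForm_skew _ _ _ _) hA0 hA1
    (fun f g => by rw [hAdef]; exact structureForm_X_sq _ _ _ _)
  have hGne : ∀ n, symmCSucc q E n ≠ 0 := fun n h =>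
    hκ (n + 1) (by rw [hκG, hG, h, zero_mul])
  obtain ⟨α, hα, hαB, hαC⟩ := exists_admissible_seq hq hE hGne
  refine ⟨α, hα, k, Q, hk, fun n => by rw [hPQ, smul_eq_C_mul],
    tendsto_coeff_awMonic hQ0 hG0 hX (fun n => ?_) fun n => ?_⟩
  · rw [hB]; exact hαB n
  · rw [hG]; exact hαC n
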